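/- **Theorem 1.3.** There exist a locally finite tree with fins $\mathbf X$ and free uniform lattices $\Gamma,\Gamma'<\operatorname{Aut}(\mathbf X)$ such that no uniform lattice $\Lambda<\operatorname{Aut}(\mathbf X)$ contains conjugates (by elements of $\operatorname{Aut}(\mathbf X)$) of both $\Gamma$ and $\Gamma'$. Here a *tree with fins* $\mathbf X$ is given by a tree $X$ and a family $(\gamma_i : Y_i\to X)_{i\in I}$ of combinatorial embeddings of trees (the *fins* $Y_i$). It is the square complex obtained as the mapping cylinder of $\bigsqcup_i\gamma_i:\bigsqcup_i Y_i\to X$, that is, $$\mathbf X = X\sqcup\bigsqcup_{i\in I} \bigl(Y_i\times[0,1]\bigr)\big/\sim,\qquad (y,0)\sim\gamma_i(y)\ \text{ for } y\in Y_i,$$ whose squares are the subspaces $e\times[0,1]$ for edges $e$ of the $Y_i$; it is *locally finite* if each vertex lies in only finitely many cells. For a locally finite tree with fins $\mathbf X$, $\operatorname{Aut}(\mathbf X)$ is the group of cubical automorphisms of $\mathbf X$ that preserve the underlying tree $X\subset\mathbf X$. A subgroup $\Gamma<\operatorname{Aut}(\mathbf X)$ is a *uniform lattice* if it acts properly and cocompactly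 on $\mathbf X$, i.e. its action on the vertex set of $\mathbf X$ has finite stabilisers and finitely many orbits. It is *free* if it acts freely on $\mathbf X$, i.e. no non-trivial element of $\Gamma$ fixes a point of $\mathbf X$ (equivalently, none maps a cell of $\mathbf X$ to itself). -/

import Mathlib

/-- The data defining a tree with fins: a tree `X` and a family of embeddings of trees
`γ i : Y i → X` (a combinatorial map of trees is an embedding iff it is injective on vertices).
The associated square complex is the mapping cylinder of the map
from the disjoint union of the `Y i` to `X` given by the `γ i`; its cells are
described below. -/
structure TreeWithFins where
  /-- vertices of the underlying tree -/
  V : Type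
  /-- the underlying tree -/
  tree : SimpleGraph V
  isTree : tree.IsTree
  /-- index set of the collection of fins -/
  ι : Type
  /-- vertices of the fins -/
  W : ι → Type
  /-- the fins -/
  fin : ∀ i, SimpleGraph (W i)
  fin_isTree : ∀ i, (fin i).IsTree
  /-- the embeddings of the fins in the underlying tree -/
  γ : ∀ i, fin i →g tree
  γ_injective : ∀ i, Function.Injective (γ i)

namespace TreeWithFins

variable (X : TreeWithFins)

/-- The vertices of the square complex: those of the underlying tree, `Sum.inl v`, and those of
the fins `Y i × {1}`, written `Sum.inr ⟨i, y⟩`. -/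
abbrev Vertex : Type := X.V ⊕ (Σ i, X.W i)

/-- The cells of the square complex (the mapping cylinder), each given by its set of vertices.
Distinct cells have distinct vertex sets. -/
inductive IsCell : Set X.Vertex → Prop
  /-- the vertices -/
  | vertex (v : X.Vertex) : IsCell {v}
  /-- the edges of the underlying tree -/
  | treeEdge {a b : X.V} (h : X.tree.Adj a b) : IsCell {Sum.inl a, Sum.inl b}
  /-- the edges of the fins -/
  | finEdge {i : X.ι} {a b : X.W i} (h : (X.fin i).Adj a b) :
      IsCell {Sum.inr ⟨i, a⟩, Sum.inr ⟨i, b⟩}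
  /-- the edges `{y} × [0,1]`, which join a vertex of a fin to its image in the tree -/
  | verticalEdge (i : X.ι) (y : X.W i) : IsCell {Sum.inl (X.γ i y), Sum.inr ⟨i, y⟩}
  /-- the squares `e × [0,1]`, for an edge `e` of a fin -/
  | square {i : X.ι} {a b : X.W i} (h : (X.fin i).Adj a b) :
      IsCell {Sum.inl (X.γ i a), Sum.inl (X.γ i b), Sum.inr ⟨i, a⟩, Sum.inr ⟨i, b⟩}

/-- The square complex is locally finite: each vertex lies in finitely many cells. -/
def LocallyFinite : Prop :=
  ∀ v : X.Vertex, {c : Set X.Vertex | X.IsCell c ∧ v ∈ c}.Finite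

/-- `Aut(𝐗)`: the cubical automorphisms of the square complex that preserve the underlying tree.
A cubical automorphism is determined by its action on the vertices; it is a permutation of the
vertices that induces a permutation of the cells (and hence preserves their dimensions, since a
cell of dimension `k` has `2 ^ k` vertices). The underlying tree consists of all the cells whose
vertices lie in the range of `Sum.inl`, so it is preserved iff this set of vertices is. -/
def autGroup : Subgroup (Equiv.Perm X.Vertex) where
  carrier := {g | (∀ c : Set X.Vertex, X.IsCell (g '' c) ↔ X.IsCell c) ∧
    g '' Set.range (Sum.inl : X.V → X.Vertex) = Set.range (Sum.inl : X.V → X.Vertex)}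
  one_mem' := by simp
  mul_mem' := by
    rintro a b ⟨ha, ha'⟩ ⟨hb, hb'⟩
    refine ⟨fun c => ?_, ?_⟩
    · rw [Equiv.Perm.coe_mul, Set.image_comp, ha, hb]
    · rw [Equiv.Perm.coe_mul, Set.image_comp, hb', ha']
  inv_mem' := by
    rintro a ⟨ha, ha'⟩
    have key : ∀ c : Set X.Vertex, a '' ((a⁻¹ : Equiv.Perm X.Vertex) '' c) = c := fun c => by
      rw [← Set.image_comp, ← Equiv.Perm.coe_mul, mul_inv_cancel]; simp
    refine ⟨fun c => ?_, ?_⟩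
    · rw [← ha, key]
    · apply a.injective.image_injective
      rw [key, ha']

/-- The group `Aut(𝐗)`. -/
abbrev Aut : Type := X.autGroup

variable {X}

/-- `Γ < Aut(𝐗)` is a uniform lattice: it acts properly and cocompactly on `𝐗`, i.e. its action
on the vertices of `𝐗` has finite stabilisers and finitely many orbits. -/
def IsUniformLattice (Γ : Subgroup X.Aut) : Prop :=
  (∀ v : X.Vertex, Finite (MulAction.stabilizer Γ v)) ∧
    Finite (MulAction.orbitRel.Quotient Γ X.Vertex)

/-- `Γ < Aut(𝐗)` acts freely on the space `𝐗`: no non-trivial element of `Γ` fixes a point of `𝐗`.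
A cubical automorphism that fixes a point maps the cell with this point in its interior to itself,
and one that maps a cell to itself fixes the centre of that cell; so this says that no non-trivial
element maps a cell to itself. -/
def ActsFreely (Γ : Subgroup X.Aut) : Prop :=
  ∀ g ∈ Γ, g ≠ 1 → ∀ c : Set X.Vertex, X.IsCell c → (g : Equiv.Perm X.Vertex) '' c ≠ c

/-- `Λ` contains a conjugate of `Γ` by an element of `Aut(𝐗)`. -/
def ContainsConjugate (Λ Γ : Subgroup X.Aut) : Prop :=
  ∃ g : X.Aut, ∀ h ∈ Γ, g * h * g⁻¹ ∈ Λ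

end TreeWithFins

/-!
The local action of an automorphism of the tree with fins constructed here at each vertex of a
regular tree of degree `120` lies in `A₅ × ℤ/60`, where `ℤ/60` acts regularly on the outgoing edges
and `A₅` on the incoming ones. The two lattices are free groups acting simply transitively on the
vertices. A lattice containing conjugates of both would have to have local action mapping onto `A₅`;
but then a generator of the first lattice conjugates the stabiliser of an outgoing edge to the
stabiliser of an incoming one, and the former has more composition factors `A₅` than the latter.
-/

/-! Write `B = ℤ/60` and `S = A₅`. The tree with fins is the Cayley tree of the free group on `B`,
with leaves indexed by `S × B` at each vertex. Each leaf at `x` records, through the multiplicities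
of the fins from it through `x`, a labelling of the edges at `x` by `B ⊕ S`. Hence every
automorphism has a local action in `S × B` at each vertex (`exists_base_nbr`), and conversely an
action on the Cayley tree with such local actions extends (`extend`). Left translation has trivial
local action and gives `Γ`. Left translation on the Cayley tree labelled through another bijection
`β'`, carried over by an isomorphism whose label changes lie in `S × B` (`frameEquiv`), gives `Γ'`.

Let `Λ` contain `Γ`, after conjugation. Since `Γ` is transitive with trivial local action, every
local action in `Λ` occurs in the stabiliser `H` of the vertex `1`. An edge labelled `i` at its
source is labelled `β i` at its target, so `β` matches the image of `H` in `B` with that in `S`. The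
choice of `β` leaves only the trivial and the full images. If they are full, a generator of `Γ`
conjugates the kernel of `H → B` into the kernel of `H → S`, which `false_of_conj_ker_le_ker`
excludes for finite `H`. So `Λ` has trivial local action everywhere. If it also contains a conjugate
of `Γ'`, then `β'` differs from `β` by translations only (`exists_eq_translate`), and a count shows
that `β'` can be chosen otherwise. -/

open SimpleGraph

/-! ### Finite groups and the choice of the bijections -/

/-- A finite subgroup `H` with a surjection onto a perfect group `S` and a map to an abelian group
`B` cannot be such that some element conjugates the kernel of the latter into the kernel of the
former: the conjugation would preserve the last term of the derived series of `H`. -/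
theorem false_of_conj_ker_le_ker {Λ S B : Type*} [Group Λ] [Group S] [CommGroup B] [Nontrivial S]
    (hS : commutator S = ⊤) (H : Subgroup Λ) [Finite H] (σS : H →* S) (σB : H →* B)
    (hσS : Function.Surjective σS) (t : Λ)
    (h : ∀ x : H, σB x = 1 → ∃ y : H, (y : Λ) = t⁻¹ * x * t ∧ σS y = 1) : False := by
  obtain ⟨n, hn⟩ : ∃ n, derivedSeries H n = derivedSeries H (n + 1) := by
    obtain ⟨n, hn⟩ := WellFoundedGT.monotone_chain_condition
      (⟨fun n => OrderDual.toDual (derivedSeries H n), derivedSeries_antitone H⟩ :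
        ℕ →o (Subgroup H)ᵒᵈ)
    exact ⟨n, hn (n + 1) n.le_succ⟩
  set D := derivedSeries H n with hD
  have hperf : ⁅D, D⁆ = D := hn.symm
  -- `D` is the perfect core of `H`, so it dies in the abelian group `B`, and conjugation by `t`
  -- embeds it in the kernel of `σS`. The image is again perfect, hence lies in `D`, and by
  -- finiteness it is all of `D`.
  have hDB : ∀ x ∈ D, σB x = 1 := by
    intro x hx
    rw [← hperf] at hx
    have h1 : ⁅D, D⁆ ≤ commutator H := Subgroup.commutator_mono le_top le_top
    exact Abelianization.commutator_subset_ker σB (h1 hx)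
  have hex : ∀ x : D, ∃ y : H, (y : Λ) = t⁻¹ * (x : H) * t ∧ σS y = 1 := fun x => h x (hDB x x.2)
  choose f hf hf1 using hex
  let ψ : D →* H :=
    { toFun := f
      map_one' := by ext; simp [hf]
      map_mul' := fun x y => by ext; simp [hf, mul_assoc] }
  have hR : ∀ k, ψ.range ≤ derivedSeries H k := by
    intro k
    induction k with
    | zero => simp
    | succ k ih =>
      have htop : (⊤ : Subgroup D) = ⁅(⊤ : Subgroup D), ⊤⁆ := by
        apply Subgroup.map_injective D.subtype_injective
        rw [Subgroup.map_commutator, ← MonoidHom.range_eq_map, Subgroup.range_subtype, hperf]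
      rw [MonoidHom.range_eq_map, htop, Subgroup.map_commutator, ← MonoidHom.range_eq_map,
        derivedSeries_succ]
      exact Subgroup.commutator_mono ih ih
  have hinj : Function.Injective ψ := by
    intro x y hxy
    have h2 : (f x : Λ) = f y := congrArg Subtype.val hxy
    rw [hf, hf] at h2
    ext
    simpa using h2
  have hsurj : Function.Surjective (fun x : D => (⟨ψ x, hR n ⟨x, rfl⟩⟩ : D)) :=
    Finite.surjective_of_injective fun x y hxy => hinj (congrArg Subtype.val hxy)
  -- Yet a surjection carries derived series to derived series, so `D` also maps onto the perfect
  -- group `S`.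
  have hDS : D.map σS = ⊥ := by
    rw [eq_bot_iff]
    rintro _ ⟨x, hx, rfl⟩
    obtain ⟨y, hy⟩ := hsurj ⟨x, hx⟩
    have h3 : f y = x := congrArg Subtype.val hy
    rw [Subgroup.mem_bot, ← h3, hf1]
  have hSk : ∀ k, derivedSeries S k = ⊤ := by
    intro k
    induction k with
    | zero => simp
    | succ k ih => rw [derivedSeries_succ, ih]; exact hS
  rw [hD, map_derivedSeries_eq hσS, hSk] at hDS
  exact top_ne_bot hDS

/-- There are `n!` bijections but at most `n²` two-sided translates of `β`, and `n² < n!` for `n ≥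
8`. -/
theorem exists_equiv_not_eq_translate {B S : Type*} [Group B] [Group S] [Finite B]
    (β : B ≃ S) (hB : 8 ≤ Nat.card B) :
    ∃ β' : B ≃ S, ∀ s b, ∃ i, β (b * i) ≠ s * β' i := by
  classical
  by_contra! hcon
  have : Fintype B := Fintype.ofFinite B
  have : Fintype S := Fintype.ofEquiv B β
  have hsurj : Function.Surjective
      (fun p : S × B => ((Equiv.mulLeft p.2).trans β).trans (Equiv.mulLeft p.1⁻¹)) := by
    intro β'
    obtain ⟨s, b, h⟩ := hcon β'
    refine ⟨(s, b), ?_⟩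
    ext i
    simp [h]
  have h1 := Fintype.card_le_of_surjective _ hsurj
  rw [Fintype.card_equiv β, Fintype.card_prod, ← Fintype.card_congr β] at h1
  rw [Nat.card_eq_fintype_card] at hB
  obtain ⟨k, hk⟩ := Nat.exists_eq_add_of_le hB
  rw [hk] at h1
  have key : ∀ k : ℕ, (8 + k) * (8 + k) < (8 + k).factorial := by
    intro k
    induction k with
    | zero => decide
    | succ k ih =>
      have : (8 + (k + 1)).factorial = (8 + k + 1) * (8 + k).factorial := Nat.factorial_succ _
      nlinarith
  exact absurd h1 (not_le.mpr (key k))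

theorem commutator_alternatingGroup_five : commutator (alternatingGroup (Fin 5)) = ⊤ :=
  commutator_alternatingGroup_eq_top (by simp)

theorem card_alternatingGroup_five : Nat.card (alternatingGroup (Fin 5)) = 60 := by
  rw [nat_card_alternatingGroup]
  simp
  decide

/-- A bijection from the cyclic group of order `60` to `A₅` that maps no proper nontrivial
subgroup to a subgroup. -/
theorem exists_equiv_alternatingGroup_five :
    ∃ β : Multiplicative (ZMod 60) ≃ alternatingGroup (Fin 5), β 1 = 1 ∧
      ∀ (L₁ : Subgroup (Multiplicative (ZMod 60))) (L₂ : Subgroup (alternatingGroup (Fin 5))),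
        (∀ x, x ∈ L₁ ↔ β x ∈ L₂) → L₂ = ⊥ ∨ L₂ = ⊤ := by
  classical
  have hexp : ∀ p : ℕ, p.Prime → p ∣ 60 → ∃ s : alternatingGroup (Fin 5), orderOf s = p :=
    fun p hp hd => by
      have := Fact.mk hp
      exact exists_prime_orderOf_dvd_card' p (by rwa [card_alternatingGroup_five])
  obtain ⟨s₂, h₂⟩ := hexp 2 (by norm_num) (by norm_num)
  obtain ⟨s₃, h₃⟩ := hexp 3 (by norm_num) (by norm_num)
  obtain ⟨s₅, h₅⟩ := hexp 5 (by norm_num) (by norm_num)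
  -- Elements of orders 2, 3, 5 are sent to elements of orders 3, 5, 2. For matching subgroups,
  -- divisibility of the common order by one of these primes then forces divisibility by all three.
  let x₂ : Multiplicative (ZMod 60) := Multiplicative.ofAdd 30
  let x₃ : Multiplicative (ZMod 60) := Multiplicative.ofAdd 20
  let x₅ : Multiplicative (ZMod 60) := Multiplicative.ofAdd 12
  let f : Multiplicative (ZMod 60) → alternatingGroup (Fin 5) := fun x =>
    if x = x₂ then s₃ else if x = x₃ then s₅ else if x = x₅ then s₂ else 1
  have n23 : x₃ ≠ x₂ := by decide
  have n25 : x₅ ≠ x₂ := by decide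
  have n35 : x₅ ≠ x₃ := by decide
  have n12 : 1 ≠ x₂ := by decide
  have n13 : 1 ≠ x₃ := by decide
  have n15 : 1 ≠ x₅ := by decide
  have f2 : f x₂ = s₃ := by simp [f]
  have f3 : f x₃ = s₅ := by simp [f, n23]
  have f5 : f x₅ = s₂ := by simp [f, n25, n35]
  have f1 : f 1 = 1 := by simp [f, n12, n13, n15]
  have o2 : orderOf (f x₂) = 3 := by rw [f2, h₃]
  have o3 : orderOf (f x₃) = 5 := by rw [f3, h₅]
  have o5 : orderOf (f x₅) = 2 := by rw [f5, h₂]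
  have o1 : orderOf (f 1) = 1 := by rw [f1, orderOf_one]
  have hcard : Fintype.card (Multiplicative (ZMod 60)) =
      (Finset.univ : Finset (alternatingGroup (Fin 5))).card := by
    rw [Finset.card_univ, ← Nat.card_eq_fintype_card (α := alternatingGroup (Fin 5)),
      card_alternatingGroup_five]
    rfl
  obtain ⟨g, hg⟩ := Finset.exists_equiv_extend_of_card_eq hcard
    (s := {1, x₂, x₃, x₅}) (f := f) (Finset.subset_univ _) (by
      intro a ha b hb hab
      have hab' := congrArg orderOf hab
      simp only [Finset.coe_insert, Finset.coe_singleton, Set.mem_insert_iff,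
        Set.mem_singleton_iff] at ha hb
      rcases ha with rfl | rfl | rfl | rfl <;> rcases hb with rfl | rfl | rfl | rfl <;>
        first
          | rfl
          | (simp only [o1, o2, o3, o5] at hab'; omega))
  refine ⟨g.trans (Equiv.subtypeUnivEquiv fun _ => Finset.mem_univ _), ?_, ?_⟩
  · change ((g 1 : (Finset.univ : Finset (alternatingGroup (Fin 5)))) :
      alternatingGroup (Fin 5)) = 1
    rw [hg 1 (by simp), f1]
  · intro L₁ L₂ hL
    change ∀ x, x ∈ L₁ ↔ (g x : alternatingGroup (Fin 5)) ∈ L₂ at hL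
    have m2 : x₂ ∈ L₁ → s₃ ∈ L₂ := fun h => by
      have := (hL x₂).1 h; rwa [hg x₂ (by simp), f2] at this
    have m3 : x₃ ∈ L₁ → s₅ ∈ L₂ := fun h => by
      have := (hL x₃).1 h; rwa [hg x₃ (by simp), f3] at this
    have m5 : x₅ ∈ L₁ → s₂ ∈ L₂ := fun h => by
      have := (hL x₅).1 h; rwa [hg x₅ (by simp), f5] at this
    have hc : Nat.card L₁ = Nat.card L₂ := by
      refine Nat.card_congr (((g.trans (Equiv.subtypeUnivEquiv fun _ =>
        Finset.mem_univ _))).subtypeEquiv fun x => hL x)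
    have hdiv : Nat.card L₂ ∣ 60 := card_alternatingGroup_five ▸ Subgroup.card_subgroup_dvd_card L₂
    have hord : ∀ s ∈ L₂, orderOf s ∣ Nat.card L₂ := fun s hs =>
      Subgroup.orderOf_dvd_natCard L₂ hs
    have hel : ∀ p : ℕ, p.Prime → p ∣ Nat.card L₂ → ∃ x ∈ L₁, orderOf x = p := by
      intro p hp hd
      have := Fact.mk hp
      obtain ⟨x, hx⟩ := exists_prime_orderOf_dvd_card' (G := L₁) p (by rwa [hc])
      exact ⟨x, x.2, by rwa [Subgroup.orderOf_coe]⟩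
    -- In a cyclic group every nontrivial element killed by the prime `p` generates the same
    -- subgroup, so the chosen element of order `p` lies in `L₁` as soon as `p` divides its order.
    have hpow : ∀ (p : ℕ) (y : Multiplicative (ZMod 60)), p.Prime → p ∣ Nat.card L₂ →
        (∀ x : Multiplicative (ZMod 60), x ^ p = 1 → x ≠ 1 → ∃ k : Fin 5, x ^ (k : ℕ) = y) →
        y ∈ L₁ := by
      intro p y hp hd hy
      obtain ⟨x, hx, ho⟩ := hel p hp hd
      obtain ⟨k, rfl⟩ := hy x (ho ▸ pow_orderOf_eq_one x) (by
        rintro rfl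
        rw [orderOf_one] at ho
        exact hp.one_lt.ne ho)
      exact L₁.pow_mem hx _
    have d2 : 2 ∣ Nat.card L₂ → 3 ∣ Nat.card L₂ := fun h =>
      h₃.symm.dvd.trans <| hord _ (m2 (hpow 2 x₂ (by norm_num) h (by decide)))
    have d3 : 3 ∣ Nat.card L₂ → 5 ∣ Nat.card L₂ := fun h =>
      h₅.symm.dvd.trans <| hord _ (m3 (hpow 3 x₃ (by norm_num) h (by decide)))
    have d5 : 5 ∣ Nat.card L₂ → 2 ∣ Nat.card L₂ := fun h =>
      h₂.symm.dvd.trans <| hord _ (m5 (hpow 5 x₅ (by norm_num) h (by decide)))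
    have hmem : Nat.card L₂ ∈ Nat.divisors 60 := by simpa using hdiv
    have hdivs : Nat.divisors 60 = {1, 2, 3, 4, 5, 6, 10, 12, 15, 20, 30, 60} := by decide
    have hcases : Nat.card L₂ = 1 ∨ Nat.card L₂ = 30 ∨ Nat.card L₂ = 60 := by
      rw [hdivs] at hmem
      simp only [Finset.mem_insert, Finset.mem_singleton] at hmem
      omega
    rcases hcases with h | h | h
    · exact Or.inl (Subgroup.card_eq_one.1 h)
    · have hi : L₂.index = 2 := by
        have := L₂.card_mul_index
        rw [h, card_alternatingGroup_five] at this
        omega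
      have := Subgroup.normal_of_index_eq_two hi
      exact this.eq_bot_or_eq_top
    · right
      apply Subgroup.eq_top_of_card_eq
      rw [h, card_alternatingGroup_five]

/-! ### Trees and locally injective maps -/

/-- At a deepest vertex of a cycle, both neighbours along the cycle are no deeper, so they would
coincide. This criterion survives attaching leaves: a leaf is one deeper than its neighbour. -/
theorem SimpleGraph.isAcyclic_of_depth {V : Type*} {G : SimpleGraph V} (d : V → ℕ)
    (hd : ∀ x y z, G.Adj x y → G.Adj x z → d y ≤ d x → d z ≤ d x → y = z) : G.IsAcyclic := by
  classical
  intro v p hp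
  obtain ⟨u, hu, hmax⟩ := p.support.toFinset.exists_max_image d ⟨v, by simp⟩
  rw [List.mem_toFinset] at hu
  have hq := hp.rotate hu
  have hmax' : ∀ w ∈ (p.rotate u hu).support, d w ≤ d u := fun w hw => by
    apply hmax
    rw [List.mem_toFinset]
    exact (Walk.mem_support_rotate_iff _ _ hu).1 hw
  exact hq.snd_ne_penultimate (hd u _ _ ((p.rotate u hu).adj_snd hq.not_nil)
    ((p.rotate u hu).adj_penultimate hq.not_nil).symm
    (hmax' _ (Walk.getVert_mem_support _ _)) (hmax' _ (Walk.getVert_mem_support _ _)))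

/-- Distinct consecutive edges express that a walk does not backtrack, and a locally injective map
creates no backtracking. -/
theorem SimpleGraph.Walk.isChain_edges_map {V V' : Type*} {G : SimpleGraph V}
    {G' : SimpleGraph V'} (f : G →g G')
    (hf : ∀ x y z, G.Adj x y → G.Adj x z → f y = f z → y = z) {u v : V} (p : G.Walk u v)
    (hp : List.IsChain (· ≠ ·) p.edges) : List.IsChain (· ≠ ·) (p.map f).edges := by
  induction p with
  | nil => simp
  | cons h p ih =>
    cases p with
    | nil => simp
    | cons h' p =>
      simp only [Walk.edges_cons, Walk.map_cons, List.isChain_cons_cons] at hp ih ⊢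
      refine ⟨?_, ih hp.2⟩
      intro he
      rw [Sym2.eq_swap, Sym2.congr_right] at he
      apply hp.1
      rw [hf _ _ _ h.symm h' he, Sym2.eq_swap]

/-- A locally injective map from a connected graph to an acyclic graph is injective. -/
theorem SimpleGraph.Connected.injective_of_isAcyclic {V V' : Type*} {G : SimpleGraph V}
    {G' : SimpleGraph V'} (hG : G.Connected) (hG' : G'.IsAcyclic) (f : G →g G')
    (hf : ∀ x y z, G.Adj x y → G.Adj x z → f y = f z → y = z) : Function.Injective f := by
  intro u v huv
  obtain ⟨p, hp⟩ := (hG.preconnected u v).exists_isPath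
  -- In an acyclic graph a walk without backtracking is a path; here it is closed, hence of length
  -- zero.
  have hc : ((p.map f).copy rfl huv.symm).IsPath := by
    rw [Walk.isPath_copy, hG'.isPath_iff_isChain]
    exact p.isChain_edges_map f hf
      (List.Pairwise.isChain (Walk.edges_nodup_of_support_nodup hp.support_nodup))
  have h0 : ((p.map f).copy rfl huv.symm).length = 0 := by
    exact Walk.length_eq_zero_iff.2 (Walk.isPath_iff_nil.1 hc)
  rw [Walk.length_copy, Walk.length_map] at h0
  exact Walk.eq_of_length_eq_zero h0

theorem SimpleGraph.Connected.surjective_of_locally_surjective {V V' : Type*} [Nonempty V]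
    {G' : SimpleGraph V'} (hG' : G'.Connected) (f : V → V')
    (hf : ∀ x y, G'.Adj (f x) y → ∃ z, f z = y) : Function.Surjective f := by
  intro y
  obtain ⟨x⟩ := ‹Nonempty V›
  obtain ⟨p⟩ := hG'.preconnected (f x) y
  suffices h : ∀ {a b : V'}, G'.Walk a b → a ∈ Set.range f → b ∈ Set.range f from h p ⟨x, rfl⟩
  intro a b p
  induction p with
  | nil => exact id
  | cons h p ih =>
    rintro ⟨z, rfl⟩
    exact ih (hf z _ h)

/-- A tree in which the neighbours of every vertex are labelled by `M`. -/
structure LabelledTree (V M : Type) where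
  graph : SimpleGraph V
  connected : graph.Connected
  depth : V → ℕ
  eq_of_depth_le : ∀ x y z, graph.Adj x y → graph.Adj x z →
    depth y ≤ depth x → depth z ≤ depth x → y = z
  nbr : V → M → V
  nbr_injective : ∀ x, Function.Injective (nbr x)
  adj_iff : ∀ x y, graph.Adj x y ↔ ∃ m, nbr x m = y

/-! ### The labelled Cayley tree of a free group -/

namespace FreeGroup

variable {B S : Type}

/-- Prepending a letter fails to lengthen a reduced word only by cancelling its first letter, which
determines the prepended letter. -/
theorem eq_of_norm_mk_cons_le [DecidableEq B] (x : FreeGroup B) (a b : B × Bool)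
    (ha : norm (mk [a] * x) ≤ norm x) (hb : norm (mk [b] * x) ≤ norm x) : a = b := by
  have key : ∀ a : B × Bool, norm (mk [a] * x) ≤ norm x →
      x.toWord.head? = some (a.1, !a.2) := by
    intro a ha
    obtain ⟨L, hL⟩ : ∃ L, x.toWord = L := ⟨_, rfl⟩
    have hr : reduce L = L := hL ▸ reduce_toWord x
    have hx : x = mk L := by rw [← hL, mk_toWord]
    rw [norm, norm, hL, hx, mul_mk, toWord_mk, List.singleton_append, reduce.cons, hr] at ha
    rw [hL]
    cases L with
    | nil => simp at ha
    | cons h t =>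
      by_cases hh : a.1 = h.1 ∧ a.2 = !h.2
      · obtain ⟨h1, h2⟩ := hh
        simp [h1, h2]
      · simp [hh] at ha
  have := (key a ha).symm.trans (key b hb)
  simpa [Prod.ext_iff] using this

theorem eq_of_norm_mul_le [DecidableEq B] (x : FreeGroup B) (a b : B × Bool)
    (ha : norm (x * mk [a]) ≤ norm x) (hb : norm (x * mk [b]) ≤ norm x) : a = b := by
  have h : ∀ a : B × Bool, norm (x * mk [a]) = norm (mk [(a.1, !a.2)] * x⁻¹) := fun a => by
    rw [← norm_inv_eq, mul_inv_rev, inv_mk]; rfl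
  rw [h, ← norm_inv_eq (x := x)] at ha hb
  have := eq_of_norm_mk_cons_le _ _ _ ha hb
  simpa [Prod.ext_iff] using this

/-- The neighbours of a vertex of the Cayley graph of a free group. The generators label the
outgoing edges, and the elements of a set in bijection with the generators label the incoming
edges. -/
def cayleyNbr (β : B ≃ S) (x : FreeGroup B) : B ⊕ S → FreeGroup B :=
  Sum.elim (fun i => x * of i) (fun w => x * (of (β.symm w))⁻¹)

/-- The letter by which a vertex is multiplied to obtain the neighbour with a given label. -/
def labelLetter (β : B ≃ S) : B ⊕ S → B × Bool :=
  Sum.elim (fun i => (i, true)) (fun w => (β.symm w, false))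

theorem labelLetter_injective (β : B ≃ S) : Function.Injective (labelLetter β) := by
  rintro (i | w) (j | w') h <;> simp [labelLetter] at h <;> simp [h]

theorem cayleyNbr_eq (β : B ≃ S) (x : FreeGroup B) (m : B ⊕ S) :
    cayleyNbr β x m = x * mk [labelLetter β m] := by
  rcases m with i | w <;> rfl

/-- The Cayley graph of a free group. -/
def cayleyGraph (β : B ≃ S) : SimpleGraph (FreeGroup B) where
  Adj x y := ∃ m, cayleyNbr β x m = y
  symm := ⟨by
    rintro x _ ⟨i | w, rfl⟩
    · exact ⟨Sum.inr (β i), by simp [cayleyNbr]⟩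
    · exact ⟨Sum.inl (β.symm w), by simp [cayleyNbr]⟩⟩
  loopless := ⟨by
    rintro x ⟨i | w, h⟩ <;> simp [cayleyNbr] at h⟩

theorem cayleyGraph_connected (β : B ≃ S) : (cayleyGraph β).Connected := by
  have : Nonempty (FreeGroup B) := ⟨1⟩
  have h : ∀ L : List (B × Bool), (cayleyGraph β).Reachable 1 (mk L) := by
    intro L
    induction L using List.reverseRecOn with
    | nil => exact SimpleGraph.Reachable.refl _
    | append_singleton L a ih =>
      refine ih.trans (SimpleGraph.Adj.reachable ?_)
      obtain ⟨i, _ | _⟩ := a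
      · exact ⟨Sum.inr (β i), by rw [cayleyNbr_eq, mul_mk]; simp [labelLetter]⟩
      · exact ⟨Sum.inl i, by rw [cayleyNbr_eq, mul_mk]; rfl⟩
  have h1 : ∀ x, (cayleyGraph β).Reachable 1 x := fun x => by
    classical
    have := h x.toWord
    rwa [mk_toWord] at this
  exact ⟨fun x y => (h1 x).symm.trans (h1 y)⟩

open Classical in
/-- The Cayley tree of a free group, labelled as in `FreeGroup.cayleyNbr`. -/
noncomputable def cayleyTree (β : B ≃ S) : LabelledTree (FreeGroup B) (B ⊕ S) where
  graph := cayleyGraph β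
  connected := cayleyGraph_connected β
  depth := norm
  eq_of_depth_le := by
    rintro x _ _ ⟨m, rfl⟩ ⟨m', rfl⟩ h h'
    rw [cayleyNbr_eq] at h h'
    rw [labelLetter_injective β (eq_of_norm_mul_le x _ _ h h')]
  nbr := cayleyNbr β
  nbr_injective := by
    intro x m m' h
    rw [cayleyNbr_eq, cayleyNbr_eq] at h
    have := congrArg toWord (mul_left_cancel h)
    exact labelLetter_injective β (by simpa [toWord_mk] using this)
  adj_iff _ _ := Iff.rfl

@[simp] theorem cayleyTree_nbr_inl (β : B ≃ S) (x : FreeGroup B) (i : B) :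
    (cayleyTree β).nbr x (Sum.inl i) = x * of i := rfl

@[simp] theorem cayleyTree_nbr_inr (β : B ≃ S) (x : FreeGroup B) (w : S) :
    (cayleyTree β).nbr x (Sum.inr w) = x * (of (β.symm w))⁻¹ := rfl

end FreeGroup

/-! ### Action of an automorphism on the tree and on the fins -/

namespace TreeWithFins

variable {X : TreeWithFins}

/-- This and the next two lemmas read incidences off the cells, which is all that an automorphism is
known to preserve. -/
theorem isCell_inl_pair {a b : X.V} (hab : a ≠ b) :
    X.IsCell {Sum.inl a, Sum.inl b} ↔ X.tree.Adj a b := by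
  refine ⟨fun h => ?_, fun h => IsCell.treeEdge h⟩
  generalize hc : ({Sum.inl a, Sum.inl b} : Set X.Vertex) = c at h
  have hsub : ∀ p, (Sum.inr p : X.Vertex) ∉ c := by rintro p; simp [← hc]
  have ha : Sum.inl a ∈ c := by simp [← hc]
  have hb : Sum.inl b ∈ c := by simp [← hc]
  cases h with
  | vertex v =>
    simp only [Set.mem_singleton_iff] at ha hb
    exact absurd (Sum.inl_injective (ha.trans hb.symm)) hab
  | treeEdge h =>
    simp only [Set.mem_insert_iff, Set.mem_singleton_iff, Sum.inl.injEq] at ha hb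
    rcases ha with rfl | rfl <;> rcases hb with rfl | rfl
    exacts [absurd rfl hab, h, h.symm, absurd rfl hab]
  | @finEdge i a' b' h => exact absurd (by simp) (hsub ⟨i, a'⟩)
  | verticalEdge i y => exact absurd (by simp) (hsub ⟨i, y⟩)
  | @square i a' b' h => exact absurd (by simp) (hsub ⟨i, a'⟩)

theorem isCell_inl_inr_pair {v : X.V} {p : Σ i, X.W i} :
    X.IsCell {Sum.inl v, Sum.inr p} ↔ X.γ p.1 p.2 = v := by
  constructor
  · intro h
    generalize hc : ({Sum.inl v, Sum.inr p} : Set X.Vertex) = c at h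
    have hr : ∀ q, (Sum.inr q : X.Vertex) ∈ c → q = p := by rintro q; simp [← hc]
    have hl : ∀ w, (Sum.inl w : X.Vertex) ∈ c → w = v := by rintro q; simp [← hc]
    have hv : Sum.inl v ∈ c := by simp [← hc]
    have hp : Sum.inr p ∈ c := by simp [← hc]
    cases h with
    | vertex w =>
      simp only [Set.mem_singleton_iff] at hv hp
      simp [← hv] at hp
    | treeEdge h => simp at hp
    | finEdge h => simp at hv
    | verticalEdge i y =>
      rw [← hr ⟨i, y⟩ (by simp)]
      exact hl _ (by simp)
    | @square i a b h =>
      have := (hr ⟨i, a⟩ (by simp)).trans (hr ⟨i, b⟩ (by simp)).symm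
      simp only [Sigma.mk.injEq, heq_eq_eq, true_and] at this
      exact absurd this h.ne
  · rintro rfl
    exact IsCell.verticalEdge p.1 p.2

theorem fst_eq_of_isCell_inr_pair {p q : Σ i, X.W i} (h : X.IsCell {Sum.inr p, Sum.inr q}) :
    p.1 = q.1 := by
  generalize hc : ({Sum.inr p, Sum.inr q} : Set X.Vertex) = c at h
  have hl : ∀ w, (Sum.inl w : X.Vertex) ∉ c := by rintro q; simp [← hc]
  have hp : Sum.inr p ∈ c := by simp [← hc]
  have hq : Sum.inr q ∈ c := by simp [← hc]
  cases h with
  | vertex w =>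
    simp only [Set.mem_singleton_iff] at hp hq
    rw [Sum.inr_injective (hp.trans hq.symm)]
  | treeEdge h => simp at hp
  | finEdge h =>
    simp only [Set.mem_insert_iff, Set.mem_singleton_iff, Sum.inr.injEq] at hp hq
    rcases hp with rfl | rfl <;> rcases hq with rfl | rfl <;> rfl
  | verticalEdge i y => exact absurd (by simp) (hl (X.γ i y))
  | @square i a b h => exact absurd (by simp) (hl (X.γ i a))

theorem Aut.exists_apply_inl (g : X.Aut) (v : X.V) :
    ∃ w, (Sum.inl w : X.Vertex) = (g : Equiv.Perm X.Vertex) (Sum.inl v) := by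
  have h := Set.mem_image_of_mem (g : Equiv.Perm X.Vertex)
    (Set.mem_range_self (f := (Sum.inl : X.V → X.Vertex)) v)
  rwa [g.2.2] at h

theorem Aut.exists_apply_inr (g : X.Aut) (p : Σ i, X.W i) :
    ∃ q, (Sum.inr q : X.Vertex) = (g : Equiv.Perm X.Vertex) (Sum.inr p) := by
  rcases h : (g : Equiv.Perm X.Vertex) (Sum.inr p) with v | q
  · obtain ⟨w, hw⟩ := Aut.exists_apply_inl g⁻¹ v
    rw [← h] at hw
    simp at hw
  · exact ⟨q, rfl⟩

/-- The action of an automorphism on the vertices of the underlying tree. -/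
noncomputable def Aut.onTree (g : X.Aut) (v : X.V) : X.V := (Aut.exists_apply_inl g v).choose

theorem Aut.inl_onTree (g : X.Aut) (v : X.V) :
    (Sum.inl (Aut.onTree g v) : X.Vertex) = (g : Equiv.Perm X.Vertex) (Sum.inl v) :=
  (Aut.exists_apply_inl g v).choose_spec

/-- The action of an automorphism on the vertices of the fins. -/
noncomputable def Aut.onFins (g : X.Aut) (p : Σ i, X.W i) : Σ i, X.W i :=
  (Aut.exists_apply_inr g p).choose

theorem Aut.inr_onFins (g : X.Aut) (p : Σ i, X.W i) :
    (Sum.inr (Aut.onFins g p) : X.Vertex) = (g : Equiv.Perm X.Vertex) (Sum.inr p) :=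
  (Aut.exists_apply_inr g p).choose_spec

theorem Aut.onTree_mul (g h : X.Aut) (v : X.V) :
    Aut.onTree (g * h) v = Aut.onTree g (Aut.onTree h v) := by
  apply Sum.inl_injective (β := Σ i, X.W i)
  rw [Aut.inl_onTree, Aut.inl_onTree, Aut.inl_onTree]
  rfl

theorem Aut.onTree_one (v : X.V) : Aut.onTree (1 : X.Aut) v = v := by
  apply Sum.inl_injective (β := Σ i, X.W i)
  rw [Aut.inl_onTree]
  rfl

theorem Aut.onFins_mul (g h : X.Aut) (p : Σ i, X.W i) :
    Aut.onFins (g * h) p = Aut.onFins g (Aut.onFins h p) := by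
  apply Sum.inr_injective (α := X.V)
  rw [Aut.inr_onFins, Aut.inr_onFins, Aut.inr_onFins]
  rfl

theorem Aut.onFins_one (p : Σ i, X.W i) : Aut.onFins (1 : X.Aut) p = p := by
  apply Sum.inr_injective (α := X.V)
  rw [Aut.inr_onFins]
  rfl

theorem Aut.onTree_injective (g : X.Aut) : Function.Injective (Aut.onTree g) := by
  intro v w h
  have := congrArg (Aut.onTree g⁻¹) h
  rwa [← Aut.onTree_mul, ← Aut.onTree_mul, inv_mul_cancel, Aut.onTree_one, Aut.onTree_one] at this

theorem Aut.onFins_injective (g : X.Aut) : Function.Injective (Aut.onFins g) := by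
  intro v w h
  have := congrArg (Aut.onFins g⁻¹) h
  rwa [← Aut.onFins_mul, ← Aut.onFins_mul, inv_mul_cancel, Aut.onFins_one, Aut.onFins_one] at this

theorem Aut.adj_onTree (g : X.Aut) {v w : X.V} (h : X.tree.Adj v w) :
    X.tree.Adj (Aut.onTree g v) (Aut.onTree g w) := by
  rw [← isCell_inl_pair ((Aut.onTree_injective g).ne h.ne), Aut.inl_onTree, Aut.inl_onTree,
    ← Set.image_pair, g.2.1]
  exact IsCell.treeEdge h

theorem Aut.γ_onFins (g : X.Aut) (p : Σ i, X.W i) :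
    X.γ (Aut.onFins g p).1 (Aut.onFins g p).2 = Aut.onTree g (X.γ p.1 p.2) := by
  rw [← isCell_inl_inr_pair, Aut.inl_onTree, Aut.inr_onFins, ← Set.image_pair, g.2.1]
  exact IsCell.verticalEdge p.1 p.2

theorem Aut.fst_onFins (g : X.Aut) {i : X.ι} {a b : X.W i} (h : (X.fin i).Adj a b) :
    (Aut.onFins g ⟨i, a⟩).1 = (Aut.onFins g ⟨i, b⟩).1 := by
  apply fst_eq_of_isCell_inr_pair
  rw [Aut.inr_onFins, Aut.inr_onFins, ← Set.image_pair, g.2.1]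
  exact IsCell.finEdge h

/-- For a group action one-sided preservation suffices, since the inverse element satisfies it too.
-/
theorem mem_autGroup_of_forall {K : Type*} [Group K] (ρ : K →* Equiv.Perm X.Vertex)
    (hcell : ∀ k c, X.IsCell c → X.IsCell (ρ k '' c))
    (hinl : ∀ k v, ∃ w, ρ k (Sum.inl v) = Sum.inl w) (k : K) : ρ k ∈ X.autGroup := by
  have hinv : ∀ c : Set X.Vertex, ρ k⁻¹ '' (ρ k '' c) = c := fun c => by
    rw [← Set.image_comp, ← Equiv.Perm.coe_mul, ← map_mul, inv_mul_cancel, map_one]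
    simp
  refine ⟨fun c => ⟨fun h => ?_, hcell k c⟩, Set.Subset.antisymm ?_ ?_⟩
  · rw [← hinv c]
    exact hcell _ _ h
  · rintro _ ⟨_, ⟨v, rfl⟩, rfl⟩
    obtain ⟨w, hw⟩ := hinl k v
    exact ⟨w, hw.symm⟩
  · rintro _ ⟨v, rfl⟩
    obtain ⟨w, hw⟩ := hinl k⁻¹ v
    refine ⟨_, ⟨w, rfl⟩, ?_⟩
    rw [← hw, ← Equiv.Perm.mul_apply, ← map_mul, mul_inv_cancel, map_one]
    rfl

theorem IsCell.finite {c : Set X.Vertex} (h : X.IsCell c) : c.Finite := by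
  cases h <;> exact Set.toFinite _

theorem IsCell.nonempty {c : Set X.Vertex} (h : X.IsCell c) : c.Nonempty := by
  cases h <;> simp

/-- A torsion-free group that acts freely on the vertices acts freely. -/
theorem actsFreely_of_torsionFree (Γ : Subgroup X.Aut)
    (hfree : ∀ g ∈ Γ, ∀ v : X.Vertex, (g : Equiv.Perm X.Vertex) v = v → g = 1)
    (htor : ∀ g ∈ Γ, ∀ n : ℕ, 0 < n → g ^ n = 1 → g = 1) : ActsFreely Γ := by
  intro g hg hg1 c hc hgc
  obtain ⟨v, hv⟩ := hc.nonempty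
  -- The powers of `g` keep `v` in a finite cell, so some positive power fixes `v` and is trivial.
  have hmaps : ∀ n : ℕ, ((g ^ n : X.Aut) : Equiv.Perm X.Vertex) v ∈ c := by
    intro n
    induction n with
    | zero => simpa using hv
    | succ n ih =>
      rw [pow_succ', ← hgc]
      exact Set.mem_image_of_mem _ ih
  have : Finite c := hc.finite
  obtain ⟨m, n, hmn, heq⟩ : ∃ m n : ℕ, m < n ∧
      ((g ^ m : X.Aut) : Equiv.Perm X.Vertex) v = ((g ^ n : X.Aut) : Equiv.Perm X.Vertex) v := by
    obtain ⟨m, n, hne, h⟩ := Finite.exists_ne_map_eq_of_infinite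
      (fun n : ℕ => (⟨_, hmaps n⟩ : c))
    have h := congrArg Subtype.val h
    rcases lt_or_gt_of_ne hne with hlt | hlt
    exacts [⟨m, n, hlt, h⟩, ⟨n, m, hlt, h.symm⟩]
  refine hg1 (htor g hg (n - m) (by omega) (hfree _ (Γ.pow_mem hg _) v ?_))
  have h1 : g ^ n = g ^ m * g ^ (n - m) := by rw [← pow_add]; congr 1; omega
  rw [h1] at heq
  exact (((g ^ m : X.Aut) : Equiv.Perm X.Vertex).injective heq).symm

end TreeWithFins

/-! ### Fins that encode a prescribed local action -/

namespace LabelledTree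

variable {V M A : Type} [Group A] (T : LabelledTree V M) (φ : A →* Equiv.Perm M) (c : M → ℕ)

/-- The tree obtained by attaching leaves indexed by `A` to each vertex of a labelled tree. -/
def leafGraph (A : Type) : SimpleGraph (V ⊕ V × A) where
  Adj
    | Sum.inl x, Sum.inl y => T.graph.Adj x y
    | Sum.inl x, Sum.inr p => p.1 = x
    | Sum.inr p, Sum.inl x => p.1 = x
    | Sum.inr _, Sum.inr _ => False
  symm := ⟨by
    rintro (x | p) (y | q) h
    exacts [h.symm, h, h, h]⟩
  loopless := ⟨by
    rintro (x | p) h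
    exacts [h.ne rfl, h]⟩

theorem leafGraph_isTree (A : Type) : (T.leafGraph A).IsTree := by
  have hinl : ∀ x y, (T.leafGraph A).Reachable (Sum.inl x) (Sum.inl y) := fun x y =>
    (T.connected.preconnected x y).map
      (⟨Sum.inl, fun h => h⟩ : T.graph →g T.leafGraph A)
  have hrep : ∀ v, ∃ x, (T.leafGraph A).Reachable (Sum.inl x) v := by
    rintro (x | p)
    · exact ⟨x, Reachable.refl _⟩
    · refine ⟨p.1, Adj.reachable ?_⟩
      exact (rfl : p.1 = p.1)
  obtain ⟨x₀⟩ := T.connected.nonempty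
  have : Nonempty (V ⊕ V × A) := ⟨Sum.inl x₀⟩
  refine ⟨⟨fun u v => ?_⟩, isAcyclic_of_depth
    (Sum.elim T.depth fun p => T.depth p.1 + 1) ?_⟩
  · obtain ⟨x, hx⟩ := hrep u
    obtain ⟨y, hy⟩ := hrep v
    exact hx.symm.trans ((hinl x y).trans hy)
  · rintro (x | p) (y | q) (z | r) hxy hxz h1 h2
    · exact congrArg _ (T.eq_of_depth_le x y z hxy hxz h1 h2)
    · obtain rfl : r.1 = x := hxz
      simp at h2
    · obtain rfl : q.1 = x := hxy
      simp at h1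
    · obtain rfl : q.1 = x := hxy
      simp at h1
    · obtain rfl : p.1 = y := hxy
      obtain rfl : p.1 = z := hxz
      rfl
    · exact hxz.elim
    · exact hxy.elim
    · exact hxy.elim

/-- The embedding of a fin: a path from a leaf at a vertex to a neighbour of the vertex. -/
def finMap (x : V) (a : A) (m : M) : Fin 3 → V ⊕ V × A :=
  ![Sum.inr (x, a), Sum.inl x, Sum.inl (T.nbr x (φ a m))]

theorem nbr_ne (x : V) (m : M) : T.nbr x m ≠ x :=
  fun h => (T.graph.ne_of_adj ((T.adj_iff x _).2 ⟨m, rfl⟩)) h.symm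

theorem finMap_injective (x : V) (a : A) (m : M) : Function.Injective (T.finMap φ x a m) := by
  have h := T.nbr_ne x (φ a m)
  intro y z hyz
  fin_cases y <;> fin_cases z <;> simp [finMap, h, h.symm] at hyz ⊢

/-- The tree with fins whose automorphisms restrict to the automorphisms of the labelled tree that
act on the labels of the neighbours of each vertex through elements of `A`. A leaf corresponding
to `a` at a vertex is joined by `c m + 1` fins to the neighbour with label `φ a m`. -/
abbrev withFins : TreeWithFins where
  V := V ⊕ V × A
  tree := T.leafGraph A
  isTree := T.leafGraph_isTree A
  ι := Σ p : V × A × M, Fin (c p.2.2 + 1)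
  W _ := Fin 3
  fin _ := starGraph 1
  fin_isTree _ := isTree_starGraph 1
  γ i :=
    { toFun := T.finMap φ i.1.1 i.1.2.1 i.1.2.2
      map_rel' := by
        intro y z h
        have hx := (T.adj_iff i.1.1 _).2 ⟨φ i.1.2.1 i.1.2.2, rfl⟩
        rw [starGraph_adj] at h
        fin_cases y <;> fin_cases z <;> simp_all [finMap, leafGraph]
        exact hx.symm }
  γ_injective i := T.finMap_injective φ _ _ _

/-- The vertex of the labelled tree near which a vertex of the tree with fins lies. -/
def basePoint : (T.withFins φ c).Vertex → V
  | Sum.inl (Sum.inl x) => x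
  | Sum.inl (Sum.inr p) => p.1
  | Sum.inr q => q.1.1.1

theorem finite_basePoint_preimage [Finite A] [Finite M] (x : V) :
    (T.basePoint φ c ⁻¹' {x}).Finite := by
  let f : (Unit ⊕ A) ⊕ (Σ p : A × M, Fin (c p.2 + 1)) × Fin 3 → (T.withFins φ c).Vertex
    | Sum.inl (Sum.inl _) => Sum.inl (Sum.inl x)
    | Sum.inl (Sum.inr a) => Sum.inl (Sum.inr (x, a))
    | Sum.inr (⟨p, k⟩, y) => Sum.inr ⟨⟨(x, p), k⟩, y⟩
  refine (Set.finite_range f).subset ?_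
  rintro ((z | ⟨z, a⟩) | ⟨⟨⟨z, p⟩, k⟩, y⟩) (rfl : _ = x)
  · exact ⟨Sum.inl (Sum.inl ()), rfl⟩
  · exact ⟨Sum.inl (Sum.inr a), rfl⟩
  · exact ⟨Sum.inr (⟨p, k⟩, y), rfl⟩

theorem basePoint_γ (i : (T.withFins φ c).ι) (y : (T.withFins φ c).W i) :
    T.basePoint φ c (Sum.inl ((T.withFins φ c).γ i y)) = i.1.1 ∨
      T.basePoint φ c (Sum.inl ((T.withFins φ c).γ i y)) =
        T.nbr i.1.1 (φ i.1.2.1 i.1.2.2) := by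
  change Fin 3 at y
  fin_cases y
  · exact Or.inl rfl
  · exact Or.inl rfl
  · exact Or.inr rfl

/-- A cell projects into a single edge or vertex of `T`. As fibres of the base point map are finite,
this yields local finiteness. -/
theorem basePoint_eq_or_adj {s : Set (T.withFins φ c).Vertex} (hs : (T.withFins φ c).IsCell s)
    {v w : (T.withFins φ c).Vertex} (hv : v ∈ s) (hw : w ∈ s) :
    T.basePoint φ c w = T.basePoint φ c v ∨
      T.graph.Adj (T.basePoint φ c v) (T.basePoint φ c w) := by
  have hnear : ∀ (i : (T.withFins φ c).ι) (a b : V),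
      (a = i.1.1 ∨ a = T.nbr i.1.1 (φ i.1.2.1 i.1.2.2)) →
      (b = i.1.1 ∨ b = T.nbr i.1.1 (φ i.1.2.1 i.1.2.2)) → b = a ∨ T.graph.Adj a b := by
    intro i a b ha hb
    have h := (T.adj_iff i.1.1 _).2 ⟨φ i.1.2.1 i.1.2.2, rfl⟩
    rcases ha with rfl | rfl <;> rcases hb with rfl | rfl
    exacts [Or.inl rfl, Or.inr h, Or.inr h.symm, Or.inl rfl]
  cases hs with
  | vertex u =>
    obtain rfl : v = u := hv
    obtain rfl : w = v := hw
    exact Or.inl rfl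
  | @treeEdge a b h =>
    have hab : T.basePoint φ c (Sum.inl b) = T.basePoint φ c (Sum.inl a) ∨
        T.graph.Adj (T.basePoint φ c (Sum.inl a)) (T.basePoint φ c (Sum.inl b)) := by
      rcases a with x | p <;> rcases b with y | q
      exacts [Or.inr h, Or.inl h, Or.inl (Eq.symm h), h.elim]
    rcases hv with rfl | rfl <;> rcases hw with rfl | rfl
    exacts [Or.inl rfl, hab, hab.imp Eq.symm SimpleGraph.Adj.symm, Or.inl rfl]
  | @finEdge i a b h =>
    refine hnear i _ _ (Or.inl ?_) (Or.inl ?_)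
    · rcases hv with rfl | rfl <;> rfl
    · rcases hw with rfl | rfl <;> rfl
  | verticalEdge i y =>
    refine hnear i _ _ ?_ ?_
    · rcases hv with rfl | rfl
      exacts [T.basePoint_γ φ c i y, Or.inl rfl]
    · rcases hw with rfl | rfl
      exacts [T.basePoint_γ φ c i y, Or.inl rfl]
  | @square i a b h =>
    refine hnear i _ _ ?_ ?_
    · rcases hv with rfl | rfl | rfl | rfl
      exacts [T.basePoint_γ φ c i a, T.basePoint_γ φ c i b, Or.inl rfl, Or.inl rfl]
    · rcases hw with rfl | rfl | rfl | rfl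
      exacts [T.basePoint_γ φ c i a, T.basePoint_γ φ c i b, Or.inl rfl, Or.inl rfl]

theorem withFins_locallyFinite [Finite A] [Finite M] : (T.withFins φ c).LocallyFinite := by
  intro v
  have hfin : (insert (T.basePoint φ c v) (Set.range (T.nbr (T.basePoint φ c v)))).Finite :=
    (Set.finite_range _).insert _
  have hpre : (T.basePoint φ c ⁻¹'
      insert (T.basePoint φ c v) (Set.range (T.nbr (T.basePoint φ c v)))).Finite :=
    hfin.preimage' fun x _ => T.finite_basePoint_preimage φ c x
  refine hpre.finite_subsets.subset ?_
  rintro s ⟨hs, hv⟩ w hw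
  rcases T.basePoint_eq_or_adj φ c hs hv hw with h | h
  · exact Or.inl h
  · exact Or.inr ((T.adj_iff _ _).1 h)

section Restriction

variable {T φ c} [Nonempty M]

open TreeWithFins

/-- A leaf has only one neighbour, while a vertex of `T` has a leaf and a vertex of `T` as
neighbours. -/
theorem exists_onTree_inl (g : (T.withFins φ c).Aut) (x : V) :
    ∃ y, Aut.onTree g (Sum.inl x : V ⊕ V × A) = (Sum.inl y : V ⊕ V × A) := by
  obtain ⟨m⟩ := ‹Nonempty M›
  rcases h : Aut.onTree g (Sum.inl x : V ⊕ V × A) with y | p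
  · exact ⟨y, rfl⟩
  · have hp : ∀ v : V ⊕ V × A, (T.leafGraph A).Adj (Sum.inr p) v → v = Sum.inl p.1 := by
      rintro (z | q) hz
      · exact congrArg Sum.inl (Eq.symm hz)
      · exact hz.elim
    have h1 : (T.leafGraph A).Adj (Sum.inl x) (Sum.inr (x, 1)) := (rfl : x = x)
    have h2 : (T.leafGraph A).Adj (Sum.inl x) (Sum.inl (T.nbr x m)) :=
      (T.adj_iff _ _).2 ⟨m, rfl⟩
    have h1' := Aut.adj_onTree (X := T.withFins φ c) g h1
    have h2' := Aut.adj_onTree (X := T.withFins φ c) g h2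
    rw [h] at h1' h2'
    have := Aut.onTree_injective g ((hp _ h1').trans (hp _ h2').symm)
    simp at this

/-- The action of an automorphism of `T.withFins φ c` on the labelled tree `T`. -/
noncomputable def base (g : (T.withFins φ c).Aut) (x : V) : V := (exists_onTree_inl g x).choose

theorem inl_base (g : (T.withFins φ c).Aut) (x : V) :
    (Sum.inl (base g x) : V ⊕ V × A) = Aut.onTree g (Sum.inl x : V ⊕ V × A) :=
  (exists_onTree_inl g x).choose_spec.symm

theorem base_one (x : V) : base (1 : (T.withFins φ c).Aut) x = x := by
  apply Sum.inl_injective (β := V × A)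
  rw [inl_base]
  exact Aut.onTree_one _

theorem base_mul (g h : (T.withFins φ c).Aut) (x : V) :
    base (g * h) x = base g (base h x) := by
  apply Sum.inl_injective (β := V × A)
  rw [inl_base, inl_base, inl_base]
  exact Aut.onTree_mul _ _ _

theorem inl_inl_base (g : (T.withFins φ c).Aut) (x : V) :
    (Sum.inl (Sum.inl (base g x) : V ⊕ V × A) : (T.withFins φ c).Vertex) =
      (g : Equiv.Perm (T.withFins φ c).Vertex) (Sum.inl (Sum.inl x : V ⊕ V × A)) := by
  rw [inl_base]
  exact Aut.inl_onTree g _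

theorem exists_onTree_inr (g : (T.withFins φ c).Aut) (x : V) (a : A) :
    ∃ a', Aut.onTree g (Sum.inr (x, a) : V ⊕ V × A) = (Sum.inr (base g x, a') : V ⊕ V × A) := by
  have h1 : (T.leafGraph A).Adj (Sum.inl x) (Sum.inr (x, a)) := (rfl : x = x)
  have h1' := Aut.adj_onTree (X := T.withFins φ c) g h1
  rcases h : Aut.onTree g (Sum.inr (x, a) : V ⊕ V × A) with y | ⟨y, a'⟩
  · have h2 := Aut.onTree_one (X := T.withFins φ c) (Sum.inr (x, a) : V ⊕ V × A)
    rw [← inv_mul_cancel g, Aut.onTree_mul, h, ← inl_base] at h2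
    simp at h2
  · rw [h, ← inl_base] at h1'
    obtain rfl : y = base g x := h1'
    exact ⟨a', rfl⟩

/-- Only position `0` of a fin lies at a leaf, so the image fin starts at the image leaf. Its middle
and far ends are then forced, and so is the neighbour it points to. -/
theorem exists_onFins (g : (T.withFins φ c).Aut) (x : V) (a a' : A)
    (ha : Aut.onTree g (Sum.inr (x, a) : V ⊕ V × A) = (Sum.inr (base g x, a') : V ⊕ V × A))
    (m : M) (k : Fin (c m + 1)) :
    ∃ (m' : M) (k' : Fin (c m' + 1)),
      Aut.onFins (X := T.withFins φ c) g ⟨⟨(x, a, m), k⟩, (0 : Fin 3)⟩ =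
        ⟨⟨(base g x, a', m'), k'⟩, (0 : Fin 3)⟩ ∧
      T.nbr (base g x) (φ a' m') = base g (T.nbr x (φ a m)) := by
  let i : (T.withFins φ c).ι := ⟨(x, a, m), k⟩
  have e0 : ((T.withFins φ c).fin i).Adj (1 : Fin 3) (0 : Fin 3) :=
    starGraph_center_adj (r := (1 : Fin 3)) (by decide)
  have e2 : ((T.withFins φ c).fin i).Adj (1 : Fin 3) (2 : Fin 3) :=
    starGraph_center_adj (r := (1 : Fin 3)) (by decide)
  have f0 := Aut.fst_onFins g e0
  have f2 := Aut.fst_onFins g e2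
  have g0 := Aut.γ_onFins g ⟨i, (0 : Fin 3)⟩
  have g1 := Aut.γ_onFins g ⟨i, (1 : Fin 3)⟩
  have g2 := Aut.γ_onFins g ⟨i, (2 : Fin 3)⟩
  have d0 : Aut.onFins g ⟨i, (2 : Fin 3)⟩ ≠ Aut.onFins g ⟨i, (1 : Fin 3)⟩ :=
    (Aut.onFins_injective g).ne (by simp [Sigma.ext_iff])
  change _ = Aut.onTree g (Sum.inr (x, a) : V ⊕ V × A) at g0
  change _ = Aut.onTree g (Sum.inl x : V ⊕ V × A) at g1
  change _ = Aut.onTree g (Sum.inl (T.nbr x (φ a m)) : V ⊕ V × A) at g2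
  rw [ha] at g0
  rw [← inl_base] at g1 g2
  generalize hq0 : Aut.onFins g ⟨i, (0 : Fin 3)⟩ = q0 at *
  generalize Aut.onFins g ⟨i, (1 : Fin 3)⟩ = q1 at *
  generalize Aut.onFins g ⟨i, (2 : Fin 3)⟩ = q2 at *
  obtain ⟨⟨⟨x0, a0, m0⟩, k0⟩, y0⟩ := q0
  obtain ⟨i1, y1⟩ := q1
  obtain ⟨i2, y2⟩ := q2
  simp only at f0 f2
  subst f0
  subst f2
  change T.finMap φ x0 a0 m0 y0 = _ at g0
  change T.finMap φ x0 a0 m0 y1 = _ at g1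
  change T.finMap φ x0 a0 m0 y2 = _ at g2
  change Fin 3 at y0 y1 y2
  have hy0 : y0 = 0 ∧ x0 = base g x ∧ a0 = a' := by
    fin_cases y0 <;> simp [finMap] at g0
    exact ⟨rfl, g0⟩
  obtain ⟨rfl, rfl, rfl⟩ := hy0
  have hy1 : y1 = 1 := by
    fin_cases y1
    · simp [finMap] at g1
    · rfl
    · simp only [finMap] at g1
      exact absurd (Sum.inl_injective g1) (T.nbr_ne _ _)
  subst hy1
  have hy2 : y2 = 2 := by
    fin_cases y2
    · simp [finMap] at g2
    · exact absurd rfl d0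
    · rfl
  subst hy2
  exact ⟨m0, k0, rfl, Sum.inl_injective g2⟩

/-- The `c m + 1` parallel fins inject into the `c m' + 1` fins joining the image leaf to the image
neighbour. -/
theorem exists_le_of_onTree_inr (g : (T.withFins φ c).Aut) (x : V) (a a' : A)
    (ha : Aut.onTree g (Sum.inr (x, a) : V ⊕ V × A) = (Sum.inr (base g x, a') : V ⊕ V × A))
    (m : M) :
    ∃ m' : M, c m ≤ c m' ∧ T.nbr (base g x) (φ a' m') = base g (T.nbr x (φ a m)) := by
  obtain ⟨m', -, -, hm'⟩ := exists_onFins g x a a' ha m 0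
  refine ⟨m', ?_, hm'⟩
  have hex : ∀ k : Fin (c m + 1), ∃ k' : Fin (c m' + 1),
      Aut.onFins (X := T.withFins φ c) g ⟨⟨(x, a, m), k⟩, (0 : Fin 3)⟩ =
        ⟨⟨(base g x, a', m'), k'⟩, (0 : Fin 3)⟩ := by
    intro k
    obtain ⟨m'', k', hk, hm''⟩ := exists_onFins g x a a' ha m k
    obtain rfl := (φ a').injective (T.nbr_injective _ (hm''.trans hm'.symm))
    exact ⟨k', hk⟩
  choose f hf using hex
  have hinj : Function.Injective f := by
    intro k l hkl
    have := Aut.onFins_injective g ((hf k).trans (hkl ▸ (hf l).symm))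
    simpa using this
  simpa using Fintype.card_le_of_injective f hinj

/-- An automorphism of `T.withFins φ c` acts on the labels of the neighbours of each vertex of `T`
through an element of `A`. -/
theorem exists_base_nbr (hc : Function.Injective c) (g : (T.withFins φ c).Aut) (x : V) :
    ∃ a : A, ∀ m, base g (T.nbr x m) = T.nbr (base g x) (φ a m) := by
  obtain ⟨a', ha'⟩ := exists_onTree_inr g x 1
  have hinv : base g⁻¹ (base g x) = x := by rw [← base_mul, inv_mul_cancel, base_one]
  have ha : Aut.onTree g⁻¹ (Sum.inr (base g x, a') : V ⊕ V × A) =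
      (Sum.inr (base g⁻¹ (base g x), 1) : V ⊕ V × A) := by
    rw [hinv, ← ha', ← Aut.onTree_mul, inv_mul_cancel, Aut.onTree_one]
  refine ⟨a', fun m => ?_⟩
  obtain ⟨m₁, h1, h2⟩ := exists_le_of_onTree_inr g x 1 a' ha' m
  -- The inverse gives the opposite inequality of multiplicities, and injectivity of `c` then shows
  -- that the label is preserved.
  obtain ⟨m₂, h3, h4⟩ := exists_le_of_onTree_inr g⁻¹ (base g x) a' 1 ha m₁
  rw [hinv, h2, ← base_mul, inv_mul_cancel, base_one] at h4
  obtain rfl := (φ 1).injective (T.nbr_injective _ h4)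
  obtain rfl := hc (le_antisymm h1 h3)
  rw [h2]
  simp

end Restriction

end LabelledTree

/-! ### Extending actions to the fins, and the local action cocycle -/

namespace LabelledTree

variable {V M A : Type} [Group A] {T : LabelledTree V M} {φ : A →* Equiv.Perm M} {c : M → ℕ}

section Extension

variable {K : Type} [Group K] (α : K →* Equiv.Perm V) (σ : K → V → A)

variable (T φ c) in
/-- The action on the vertices of `T.withFins φ c` of a group that acts on `V` with local action
given by a cocycle. -/
def extendFun (k : K) : (T.withFins φ c).Vertex → (T.withFins φ c).Vertex
  | Sum.inl (Sum.inl x) => Sum.inl (Sum.inl (α k x))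
  | Sum.inl (Sum.inr p) => Sum.inl (Sum.inr (α k p.1, σ k p.1 * p.2))
  | Sum.inr ⟨⟨p, j⟩, y⟩ => Sum.inr ⟨⟨(α k p.1, σ k p.1 * p.2.1, p.2.2), j⟩, y⟩

variable (hσ : ∀ k l x, σ (k * l) x = σ k (α l x) * σ l x)
  (hnbr : ∀ k x m, α k (T.nbr x m) = T.nbr (α k x) (φ (σ k x) m))

variable (T φ c) in
/-- `LabelledTree.extendFun` as a homomorphism. -/
def extendPerm : K →* Equiv.Perm (T.withFins φ c).Vertex :=
  MonoidHom.toHomPerm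
    { toFun := T.extendFun φ c α σ
      map_one' := by
        have h1 : ∀ x, σ 1 x = 1 := fun x => by simpa using hσ 1 1 x
        funext v
        rcases v with (x | p) | ⟨⟨⟨x, a, m⟩, j⟩, y⟩
        · simp [extendFun]; rfl
        · simp [extendFun, h1]; rfl
        · have h2 : σ 1 x * a = a := by rw [h1, one_mul]
          have h3 : α 1 x = x := by rw [map_one]; rfl
          change (Sum.inr ⟨⟨(α 1 x, σ 1 x * a, m), j⟩, y⟩ : (T.withFins φ c).Vertex) = _
          rw [h2, h3]
          rfl
      map_mul' := fun k l => by
        funext v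
        change _ = T.extendFun φ c α σ k (T.extendFun φ c α σ l v)
        rcases v with (x | p) | ⟨⟨p, j⟩, y⟩ <;> simp [extendFun, hσ, mul_assoc] }

theorem extendPerm_apply (k : K) (v : (T.withFins φ c).Vertex) :
    T.extendPerm φ c α σ hσ k v = T.extendFun φ c α σ k v := rfl

theorem basePoint_extendFun (k : K) (v : (T.withFins φ c).Vertex) :
    T.basePoint φ c (T.extendFun φ c α σ k v) = α k (T.basePoint φ c v) := by
  rcases v with (x | p) | ⟨⟨p, j⟩, y⟩ <;> rfl

include hnbr in
theorem extendPerm_mem_autGroup (k : K) :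
    T.extendPerm φ c α σ hσ k ∈ (T.withFins φ c).autGroup := by
  have hadj : ∀ k x y, T.graph.Adj x y → T.graph.Adj (α k x) (α k y) := by
    intro k x y h
    obtain ⟨m, rfl⟩ := (T.adj_iff _ _).1 h
    exact (T.adj_iff _ _).2 ⟨_, (hnbr k x m).symm⟩
  have hγ : ∀ (k : K) (i : (T.withFins φ c).ι) (y : (T.withFins φ c).W i),
      T.extendFun φ c α σ k (Sum.inl ((T.withFins φ c).γ i y)) =
        Sum.inl ((T.withFins φ c).γ
          ⟨(α k i.1.1, σ k i.1.1 * i.1.2.1, i.1.2.2), i.2⟩ y) := by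
    intro k i y
    change Fin 3 at y
    fin_cases y
    · rfl
    · rfl
    · simp [extendFun, finMap, hnbr]
  refine TreeWithFins.mem_autGroup_of_forall _ ?_ ?_ k
  · intro k s hs
    cases hs with
    | vertex v =>
      rw [Set.image_singleton]
      exact TreeWithFins.IsCell.vertex _
    | @treeEdge a b h =>
      rw [Set.image_pair]
      rcases a with x | p <;> rcases b with y | q
      · exact TreeWithFins.IsCell.treeEdge (X := T.withFins φ c)
          (a := (Sum.inl (α k x))) (b := Sum.inl (α k y)) (hadj k x y h)
      · exact TreeWithFins.IsCell.treeEdge (X := T.withFins φ c)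
          (a := (Sum.inl (α k x))) (b := Sum.inr (α k q.1, σ k q.1 * q.2)) (congrArg (α k) h)
      · exact TreeWithFins.IsCell.treeEdge (X := T.withFins φ c)
          (a := Sum.inr (α k p.1, σ k p.1 * p.2)) (b := (Sum.inl (α k y))) (congrArg (α k) h)
      · exact h.elim
    | @finEdge i a b h =>
      rw [Set.image_pair]
      exact TreeWithFins.IsCell.finEdge (X := T.withFins φ c)
        (i := ⟨(α k i.1.1, σ k i.1.1 * i.1.2.1, i.1.2.2), i.2⟩) h
    | verticalEdge i y =>
      rw [Set.image_pair, extendPerm_apply, hγ]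
      exact TreeWithFins.IsCell.verticalEdge (X := T.withFins φ c)
        ⟨(α k i.1.1, σ k i.1.1 * i.1.2.1, i.1.2.2), i.2⟩ y
    | @square i a b h =>
      rw [Set.image_insert_eq, Set.image_insert_eq, Set.image_pair, extendPerm_apply,
        extendPerm_apply, hγ, hγ]
      exact TreeWithFins.IsCell.square (X := T.withFins φ c)
        (i := ⟨(α k i.1.1, σ k i.1.1 * i.1.2.1, i.1.2.2), i.2⟩) h
  · rintro k (x | p)
    exacts [⟨_, rfl⟩, ⟨_, rfl⟩]

/-- A group acting on a labelled tree with local action in `A` acts on the associated tree with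
fins. -/
def extend : K →* (T.withFins φ c).Aut :=
  (T.extendPerm φ c α σ hσ).codRestrict _ (extendPerm_mem_autGroup α σ hσ hnbr)

theorem extend_apply (k : K) (v : (T.withFins φ c).Vertex) :
    (extend (c := c) α σ hσ hnbr k : Equiv.Perm (T.withFins φ c).Vertex) v =
      T.extendFun φ c α σ k v := rfl

theorem base_extend [Nonempty M] (k : K) (x : V) :
    base (extend (c := c) α σ hσ hnbr k) x = α k x := by
  have h := inl_inl_base (extend (c := c) α σ hσ hnbr k) x
  exact Sum.inl_injective (Sum.inl_injective h)

/-- The base point map is equivariant with finite fibres, so stabilisers are trivial and one fibre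
meets every orbit. -/
theorem extend_range_isUniformLattice [Finite A] [Finite M]
    (hfree : ∀ k x, α k x = x → k = 1) (htrans : ∀ x y, ∃ k, α k x = y) :
    TreeWithFins.IsUniformLattice (extend (c := c) α σ hσ hnbr).range := by
  constructor
  · intro v
    have : Subsingleton (MulAction.stabilizer (extend (c := c) α σ hσ hnbr).range v) := by
      suffices h : ∀ g : MulAction.stabilizer (extend (c := c) α σ hσ hnbr).range v, g = 1 from
        ⟨fun g g' => (h g).trans (h g').symm⟩
      rintro ⟨⟨_, k, rfl⟩, hk⟩
      have hk' : T.extendFun φ c α σ k v = v := hk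
      have := basePoint_extendFun α σ (φ := φ) (c := c) k v
      rw [hk'] at this
      obtain rfl := hfree k _ this.symm
      ext1
      ext1
      simp
    infer_instance
  · obtain ⟨x₀⟩ := T.connected.nonempty
    have : Finite (T.basePoint φ c ⁻¹' {x₀}) := T.finite_basePoint_preimage φ c x₀
    refine Finite.of_surjective (fun v : T.basePoint φ c ⁻¹' {x₀} =>
      (Quotient.mk'' v.1 : MulAction.orbitRel.Quotient (extend (c := c) α σ hσ hnbr).range _)) ?_
    intro q
    induction q using Quotient.inductionOn' with
    | h v =>
      obtain ⟨k, hk⟩ := htrans (T.basePoint φ c v) x₀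
      refine ⟨⟨T.extendFun φ c α σ k v, by
        rw [Set.mem_preimage, basePoint_extendFun, hk]; rfl⟩, ?_⟩
      refine Quotient.sound' ?_
      exact ⟨⟨_, k, rfl⟩, rfl⟩

theorem extend_range_actsFreely [IsMulTorsionFree K] (hfree : ∀ k x, α k x = x → k = 1) :
    TreeWithFins.ActsFreely (extend (c := c) α σ hσ hnbr).range := by
  have key : ∀ k v, T.extendFun φ c α σ k v = v → k = 1 := by
    intro k v hk
    have := basePoint_extendFun α σ (φ := φ) (c := c) k v
    rw [hk] at this
    exact hfree k _ this.symm
  apply TreeWithFins.actsFreely_of_torsionFree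
  · rintro _ ⟨k, rfl⟩ v hv
    rw [key k v hv, map_one]
  · rintro _ ⟨k, rfl⟩ n hn hk
    obtain ⟨x₀⟩ := T.connected.nonempty
    rw [← map_pow] at hk
    have h1 : k ^ n = 1 := by
      apply key _ (Sum.inl (Sum.inl x₀))
      rw [← extend_apply α σ hσ hnbr, hk]
      rfl
    rw [(pow_eq_one_iff_left hn.ne').1 h1, map_one]

end Extension

section LocalAction

variable [Nonempty M] (hφ : Function.Injective φ) (hc : Function.Injective c)

/-- The local action of an automorphism at a vertex of the labelled tree. -/
noncomputable def loc (hc : Function.Injective c) (g : (T.withFins φ c).Aut) (x : V) : A :=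
  (exists_base_nbr hc g x).choose

theorem base_nbr (g : (T.withFins φ c).Aut) (x : V) (m : M) :
    base g (T.nbr x m) = T.nbr (base g x) (φ (loc hc g x) m) :=
  (exists_base_nbr hc g x).choose_spec m

include hφ in
theorem loc_eq (g : (T.withFins φ c).Aut) (x : V) (a : A)
    (h : ∀ m, base g (T.nbr x m) = T.nbr (base g x) (φ a m)) : loc hc g x = a := by
  apply hφ
  ext m
  apply T.nbr_injective (base g x)
  rw [← base_nbr, h]

include hφ in
theorem loc_mul (g h : (T.withFins φ c).Aut) (x : V) :
    loc hc (g * h) x = loc hc g (base h x) * loc hc h x := by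
  apply loc_eq hφ
  intro m
  rw [base_mul, base_nbr hc, base_nbr hc, base_mul, map_mul]
  rfl

include hφ in
theorem loc_extend {K : Type} [Group K] (α : K →* Equiv.Perm V) (σ : K → V → A)
    (hσ : ∀ k l x, σ (k * l) x = σ k (α l x) * σ l x)
    (hnbr : ∀ k x m, α k (T.nbr x m) = T.nbr (α k x) (φ (σ k x) m)) (k : K) (x : V) :
    loc hc (extend α σ hσ hnbr k) x = σ k x := by
  apply loc_eq hφ
  intro m
  rw [base_extend, base_extend, hnbr]

end LocalAction

end LabelledTree

open LabelledTree

/-! ### The two lattices -/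

namespace FreeGroup

variable {B S : Type}

theorem mul_cayleyTree_nbr (β : B ≃ S) (u w : FreeGroup B) (m : B ⊕ S) :
    u * (cayleyTree β).nbr w m = (cayleyTree β).nbr (u * w) m := by
  rcases m with i | s <;> simp [mul_assoc]

section Transport

variable {V A : Type} [Group A] {T : LabelledTree V (B ⊕ S)} {φ : A →* Equiv.Perm (B ⊕ S)}
  (β : B ≃ S) (e : FreeGroup B ≃ V) (a : FreeGroup B → A)

/-- The action of a free group on a set in bijection with it. -/
def transport (e : FreeGroup B ≃ V) : FreeGroup B →* Equiv.Perm V where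
  toFun u := (e.symm.trans (Equiv.mulLeft u)).trans e
  map_one' := by ext; simp
  map_mul' u v := by ext; simp

theorem transport_apply (u w : FreeGroup B) : transport e u (e w) = e (u * w) := by
  simp [transport]

/-- The local action of the free group on a labelled tree that is isomorphic to a Cayley tree
through `e`, with local action `a`. -/
def transportCocycle (u : FreeGroup B) (x : V) : A := a (u * e.symm x) * (a (e.symm x))⁻¹

theorem transportCocycle_mul (u v : FreeGroup B) (x : V) :
    transportCocycle e a (u * v) x =
      transportCocycle e a u (transport e v x) * transportCocycle e a v x := by
  simp [transportCocycle, transport, mul_assoc]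

/-- Left translation preserves Cayley labels, so its local action as seen through `e` is the change
from `a w` to `a (u * w)`. -/
theorem transport_nbr
    (h : ∀ w m, e ((cayleyTree β).nbr w m) = T.nbr (e w) (φ (a w) m))
    (u : FreeGroup B) (x : V) (m : B ⊕ S) :
    transport e u (T.nbr x m) = T.nbr (transport e u x) (φ (transportCocycle e a u x) m) := by
  obtain ⟨w, rfl⟩ := e.surjective x
  have h1 : T.nbr (e w) m = e ((cayleyTree β).nbr w (φ (a w)⁻¹ m)) := by
    rw [h, ← Equiv.Perm.mul_apply, ← _root_.map_mul, mul_inv_cancel, _root_.map_one]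
    rfl
  rw [h1, transport_apply, transport_apply, mul_cayleyTree_nbr, h, transportCocycle,
    Equiv.symm_apply_apply, _root_.map_mul φ, _root_.map_inv]
  rfl

theorem transport_free (u : FreeGroup B) (x : V) (h : transport e u x = x) : u = 1 := by
  obtain ⟨w, rfl⟩ := e.surjective x
  rw [transport_apply] at h
  simpa using e.injective h

theorem transport_transitive (x y : V) : ∃ u, transport e u x = y := by
  obtain ⟨w, rfl⟩ := e.surjective x
  obtain ⟨w', rfl⟩ := e.surjective y
  exact ⟨w' * w⁻¹, by rw [transport_apply]; simp⟩

end Transport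

variable [Group B] [Group S]

/-- The action of `S × B` on the labels of the neighbours of a vertex of a Cayley tree. -/
def labelHom (B S : Type) [Group B] [Group S] : S × B →* Equiv.Perm (B ⊕ S) where
  toFun p := Equiv.sumCongr (Equiv.mulLeft p.2) (Equiv.mulLeft p.1)
  map_one' := by ext (i | s) <;> simp
  map_mul' p q := by ext (i | s) <;> simp [mul_assoc]

@[simp] theorem labelHom_inl (p : S × B) (i : B) :
    labelHom B S p (Sum.inl i) = Sum.inl (p.2 * i) := rfl

@[simp] theorem labelHom_inr (p : S × B) (s : S) :
    labelHom B S p (Sum.inr s) = Sum.inr (p.1 * s) := rfl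

theorem labelHom_injective : Function.Injective (labelHom B S) := by
  rintro ⟨s, b⟩ ⟨s', b'⟩ h
  have h1 := congrArg (fun f => f (Sum.inl 1)) h
  have h2 := congrArg (fun f => f (Sum.inr 1)) h
  simp at h1 h2
  rw [h1, h2]

/-- A generator of a right action of the free group on the frames, that is, the pairs of a vertex
of the Cayley tree and an element of `S × B`. -/
def frameStep (β β' : B ≃ S) (i : B) : Equiv.Perm (FreeGroup B × S × B) where
  -- The new `S`-component is forced: the edge just crossed is labelled `β' i` at its target, and
  -- its image `β (b * i)`. The new `B`-component is free; this choice makes the map on `S × B` an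
  -- involution, so that a step backwards obeys the same compatibility.
  toFun p := (p.1 * of (p.2.2 * i), β (p.2.2 * i) * (β' i)⁻¹, β.symm (p.2.1 * β' i) * i⁻¹)
  invFun p := (p.1 * (of (β.symm (p.2.1 * β' i)))⁻¹, β (p.2.2 * i) * (β' i)⁻¹,
    β.symm (p.2.1 * β' i) * i⁻¹)
  left_inv p := by simp
  right_inv p := by simp

/-- The frame at the image of a word under the isomorphism between the Cayley trees labelled
through `β'` and `β`. -/
def frame (β β' : B ≃ S) (w : FreeGroup B) : FreeGroup B × S × B :=
  -- The opposite group appears because the last letter of the word must act last.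
  (lift (fun i => MulOpposite.op (frameStep β β' i)) w).unop (1, 1)

theorem frame_nbr (β β' : B ≃ S) (w : FreeGroup B) (m : B ⊕ S) :
    (frame β β' ((cayleyTree β').nbr w m)).1 =
      (cayleyTree β).nbr (frame β β' w).1 (labelHom B S (frame β β' w).2 m) := by
  rcases m with i | s
  · simp [frame, frameStep]
  · simp only [frame, cayleyTree_nbr_inr, _root_.map_mul, _root_.map_inv, lift_apply_of, MulOpposite.unop_mul,
      MulOpposite.unop_inv, MulOpposite.unop_op, Equiv.Perm.mul_apply, labelHom_inr]
    rw [Equiv.Perm.inv_def]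
    simp [frameStep]

/-- The map is bijective on the neighbours of each vertex, and such a map between trees is an
isomorphism. -/
theorem frame_fst_bijective (β β' : B ≃ S) :
    Function.Bijective fun w => (frame β β' w).1 := by
  constructor
  · have hacyc : (cayleyTree β).graph.IsAcyclic :=
      isAcyclic_of_depth (cayleyTree β).depth (cayleyTree β).eq_of_depth_le
    refine (cayleyTree β').connected.injective_of_isAcyclic hacyc
      ⟨fun w => (frame β β' w).1, ?_⟩ ?_
    · intro x y h
      obtain ⟨m, rfl⟩ := ((cayleyTree β').adj_iff _ _).1 h
      exact ((cayleyTree β).adj_iff _ _).2 ⟨_, (frame_nbr β β' x m).symm⟩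
    · intro x y z hy hz h
      obtain ⟨m, rfl⟩ := ((cayleyTree β').adj_iff _ _).1 hy
      obtain ⟨m', rfl⟩ := ((cayleyTree β').adj_iff _ _).1 hz
      change (frame β β' _).1 = (frame β β' _).1 at h
      rw [frame_nbr, frame_nbr] at h
      rw [(labelHom B S _).injective ((cayleyTree β).nbr_injective _ h)]
  · have : Nonempty (FreeGroup B) := ⟨1⟩
    refine (cayleyTree β).connected.surjective_of_locally_surjective _ ?_
    intro x y h
    obtain ⟨m, rfl⟩ := ((cayleyTree β).adj_iff _ _).1 h
    refine ⟨(cayleyTree β').nbr x (labelHom B S (frame β β' x).2⁻¹ m), ?_⟩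
    rw [frame_nbr, ← Equiv.Perm.mul_apply, ← _root_.map_mul, mul_inv_cancel, _root_.map_one]
    rfl

/-- The isomorphism between the Cayley trees labelled through `β'` and `β`. -/
noncomputable def frameEquiv (β β' : B ≃ S) : FreeGroup B ≃ FreeGroup B :=
  Equiv.ofBijective _ (frame_fst_bijective β β')

theorem frameEquiv_nbr (β β' : B ≃ S) (w : FreeGroup B) (m : B ⊕ S) :
    frameEquiv β β' ((cayleyTree β').nbr w m) =
      (cayleyTree β).nbr (frameEquiv β β' w) (labelHom B S (frame β β' w).2 m) :=
  frame_nbr β β' w m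

variable (β β' : B ≃ S) (c : B ⊕ S → ℕ)

/-- The action of the free group on the tree with fins associated to the Cayley tree labelled
through `β`, by way of the isomorphism from the Cayley tree labelled through `β'`. -/
noncomputable def twistedHom :
    FreeGroup B →* ((cayleyTree β).withFins (labelHom B S) c).Aut :=
  extend (transport (frameEquiv β β')) (transportCocycle (frameEquiv β β') fun w =>
    (frame β β' w).2) (transportCocycle_mul _ _) (transport_nbr β' _ _ (frameEquiv_nbr β β'))

/-- The action of the free group on the tree with fins associated to its Cayley tree. -/
noncomputable def leftHom :
    FreeGroup B →* ((cayleyTree β).withFins (labelHom B S) c).Aut :=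
  extend (transport (Equiv.refl _)) (transportCocycle (Equiv.refl _) fun _ => 1)
    (transportCocycle_mul _ _) (transport_nbr β _ _ fun w m => by simp)

theorem twistedHom_range [Finite B] [Finite S] :
    TreeWithFins.IsUniformLattice (twistedHom β β' c).range ∧
      TreeWithFins.ActsFreely (twistedHom β β' c).range :=
  ⟨extend_range_isUniformLattice _ _ _ _ (transport_free _) (transport_transitive _),
    extend_range_actsFreely _ _ _ _ (transport_free _)⟩

theorem leftHom_range [Finite B] [Finite S] :
    TreeWithFins.IsUniformLattice (leftHom β c).range ∧
      TreeWithFins.ActsFreely (leftHom β c).range :=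
  ⟨extend_range_isUniformLattice _ _ _ _ (transport_free _) (transport_transitive _),
    extend_range_actsFreely _ _ _ _ (transport_free _)⟩

variable {β β' c}

theorem base_leftHom (u x : FreeGroup B) : base (leftHom β c u) x = u * x := by
  rw [leftHom, base_extend]
  rfl

theorem base_twistedHom (u w : FreeGroup B) :
    base (twistedHom β β' c u) (frameEquiv β β' w) = frameEquiv β β' (u * w) := by
  rw [twistedHom, base_extend, transport_apply]

variable (hc : Function.Injective c)

theorem loc_leftHom (u x : FreeGroup B) : loc hc (leftHom β c u) x = 1 := by
  rw [leftHom, loc_extend labelHom_injective]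
  simp [transportCocycle]

theorem loc_twistedHom (u w : FreeGroup B) :
    loc hc (twistedHom β β' c u) (frameEquiv β β' w) =
      (frame β β' (u * w)).2 * ((frame β β' w).2)⁻¹ := by
  rw [twistedHom, loc_extend labelHom_injective]
  simp [transportCocycle]

/-- If a group containing the conjugate of the twisted action by `h` has trivial local action, then
the two labellings differ by a translation. -/
theorem exists_eq_translate (Λ : Subgroup ((cayleyTree β).withFins (labelHom B S) c).Aut)
    (hΛ : ∀ g ∈ Λ, ∀ x, loc hc g x = 1) (h : ((cayleyTree β).withFins (labelHom B S) c).Aut)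
    (hh : ∀ u, h * twistedHom β β' c u * h⁻¹ ∈ Λ) : ∃ s b, ∀ i, β (b * i) = s * β' i := by
  -- Trivial local action of the conjugates makes the label change of `h` composed with the
  -- relabelling isomorphism the same at every vertex.
  have hloc : ∀ u, loc hc h (frameEquiv β β' u) * (frame β β' u).2 =
      loc hc h (frameEquiv β β' 1) * (frame β β' 1).2 := by
    intro u
    have h1 := loc_mul labelHom_injective hc (h * twistedHom β β' c u * h⁻¹) h
      (frameEquiv β β' 1)
    rw [hΛ _ (hh u), inv_mul_cancel_right, loc_mul labelHom_injective, loc_twistedHom,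
      base_twistedHom, mul_one, one_mul, ← mul_assoc, mul_inv_eq_iff_eq_mul] at h1
    exact h1
  obtain ⟨⟨s, b⟩, hsb⟩ : ∃ p, loc hc h (frameEquiv β β' 1) * (frame β β' 1).2 = p := ⟨_, rfl⟩
  have hnbr : ∀ w m, base h (frameEquiv β β' ((cayleyTree β').nbr w m)) =
      (cayleyTree β).nbr (base h (frameEquiv β β' w)) (labelHom B S (s, b) m) := by
    intro w m
    rw [frameEquiv_nbr, base_nbr hc, ← hsb, ← hloc w, _root_.map_mul]
    rfl
  refine ⟨s, b, fun i => ?_⟩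
  -- Crossing the edge labelled `i` and returning along its label `β' i` at the other end compares
  -- `b * i` with `s * β' i`.
  have h1 := hnbr 1 (Sum.inl i)
  have h2 := hnbr ((cayleyTree β').nbr 1 (Sum.inl i)) (Sum.inr (β' i))
  rw [h1] at h2
  simp only [cayleyTree_nbr_inl, cayleyTree_nbr_inr, labelHom_inl, labelHom_inr,
    Equiv.symm_apply_apply, mul_inv_cancel, one_mul] at h2
  rw [mul_assoc, left_eq_mul, mul_inv_eq_one] at h2
  rw [of_injective h2, Equiv.apply_symm_apply]

end FreeGroup

/-! ### Lattices containing the left translations -/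

namespace FreeGroup

variable {B S : Type} [CommGroup B] [Group S] {β β' : B ≃ S} {c : B ⊕ S → ℕ}

/-- The local action at the identity of the stabiliser of the identity in `Λ`. -/
noncomputable def locHom (hc : Function.Injective c)
    (H : Subgroup ((cayleyTree β).withFins (labelHom B S) c).Aut)
    (hH : ∀ g ∈ H, base g 1 = 1) : H →* S × B where
  toFun g := loc hc (g : ((cayleyTree β).withFins (labelHom B S) c).Aut) 1
  map_one' := loc_eq labelHom_injective hc _ _ _ fun m => by
    rw [OneMemClass.coe_one, base_one, base_one, _root_.map_one]; rfl
  map_mul' g h := by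
    rw [Subgroup.coe_mul, loc_mul labelHom_injective, hH h h.2]

/-- A subgroup with finite stabilisers that contains the free group cannot have local action
mapping onto a nontrivial perfect group `S`. -/
theorem eq_one_of_forall_leftHom_mem [Nontrivial S] (hS : commutator S = ⊤) (hβ1 : β 1 = 1)
    (hβ : ∀ (L₁ : Subgroup B) (L₂ : Subgroup S), (∀ x, x ∈ L₁ ↔ β x ∈ L₂) → L₂ = ⊥ ∨ L₂ = ⊤)
    (hc : Function.Injective c)
    (Λ : Subgroup ((cayleyTree β).withFins (labelHom B S) c).Aut)
    (hfin : Finite {g : ((cayleyTree β).withFins (labelHom B S) c).Aut // g ∈ Λ ∧ base g 1 = 1})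
    (hΛ : ∀ u, leftHom β c u ∈ Λ) : ∀ g ∈ Λ, ∀ x, loc hc g x = 1 := by
  let H : Subgroup ((cayleyTree β).withFins (labelHom B S) c).Aut :=
    { carrier := {g | g ∈ Λ ∧ base g 1 = 1}
      one_mem' := ⟨Λ.one_mem, base_one 1⟩
      mul_mem' := fun {g h} hg hh => ⟨Λ.mul_mem hg.1 hh.1, by rw [base_mul, hh.2, hg.2]⟩
      inv_mem' := fun {g} hg => ⟨Λ.inv_mem hg.1, by
        nth_rw 1 [← hg.2]
        rw [← base_mul, inv_mul_cancel, base_one]⟩ }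
  have hH1 : ∀ g ∈ H, base g 1 = 1 := fun g hg => hg.2
  have : Finite H := hfin
  let σS : H →* S := (MonoidHom.fst S B).comp (locHom hc H hH1)
  let σB : H →* B := (MonoidHom.snd S B).comp (locHom hc H hH1)
  have hσS : ∀ g : H, σS g = (loc hc (g : ((cayleyTree β).withFins (labelHom B S) c).Aut) 1).1 :=
    fun _ => rfl
  have hσB : ∀ g : H, σB g = (loc hc (g : ((cayleyTree β).withFins (labelHom B S) c).Aut) 1).2 :=
    fun _ => rfl
  -- moving the local action at any vertex to the identity
  have hmove : ∀ g ∈ Λ, ∀ x, ∃ h ∈ H, h = (leftHom β c (base g x))⁻¹ * g * leftHom β c x ∧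
      loc hc h 1 = loc hc g x := by
    intro g hg x
    refine ⟨_, ⟨Λ.mul_mem (Λ.mul_mem (Λ.inv_mem (hΛ _)) hg) (hΛ _), ?_⟩, rfl, ?_⟩
    · rw [base_mul, base_mul, base_leftHom, mul_one, ← _root_.map_inv, base_leftHom, inv_mul_cancel]
    · rw [loc_mul labelHom_injective, loc_mul labelHom_injective, base_leftHom, mul_one,
        loc_leftHom, mul_one, ← _root_.map_inv, loc_leftHom, one_mul]
  -- The edge from `1` to `of 1` has label `1` at both ends because `β 1 = 1`; its image under `g`
  -- has labels matched by `β`.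
  have hout : ∀ g ∈ H, base g (of 1) = of (loc hc g 1).2 ∧
      (loc hc g (of 1)).1 = β (loc hc g 1).2 := by
    intro g hg
    have h1 := base_nbr hc g 1 (Sum.inl 1)
    have h2 := base_nbr hc g (of 1) (Sum.inr 1)
    have e1 : β.symm 1 = 1 := by rw [← hβ1, Equiv.symm_apply_apply]
    rw [hH1 g hg] at h1
    simp only [cayleyTree_nbr_inl, labelHom_inl, one_mul, mul_one] at h1
    simp only [cayleyTree_nbr_inr, labelHom_inr, e1, mul_inv_cancel, h1, hH1 g hg, mul_one] at h2
    refine ⟨h1, ?_⟩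
    rw [eq_comm, mul_inv_eq_one] at h2
    rw [of_injective h2, Equiv.apply_symm_apply]
  have hin : ∀ g ∈ H, (loc hc g (of 1)⁻¹).2 = β.symm (loc hc g 1).1 := by
    intro g hg
    have h1 := base_nbr hc g 1 (Sum.inr 1)
    have h2 := base_nbr hc g (of 1)⁻¹ (Sum.inl 1)
    have e1 : β.symm 1 = 1 := by rw [← hβ1, Equiv.symm_apply_apply]
    rw [hH1 g hg] at h1
    simp only [cayleyTree_nbr_inr, labelHom_inr, one_mul, mul_one, e1] at h1
    simp only [cayleyTree_nbr_inl, labelHom_inl, inv_mul_cancel, h1, hH1 g hg, mul_one] at h2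
    rw [eq_comm, inv_mul_eq_one] at h2
    exact (of_injective h2).symm
  have hmatch : ∀ x, x ∈ σB.range ↔ β x ∈ σS.range := by
    intro x
    constructor
    · rintro ⟨⟨g, hg⟩, rfl⟩
      obtain ⟨h, hh, -, hl⟩ := hmove g hg.1 (of 1)
      exact ⟨⟨h, hh⟩, by rw [hσS, hσB, hl, (hout g hg).2]⟩
    · rintro ⟨⟨g, hg⟩, hgx⟩
      obtain ⟨h, hh, -, hl⟩ := hmove g hg.1 (of 1)⁻¹
      refine ⟨⟨h, hh⟩, ?_⟩
      rw [hσS] at hgx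
      rw [hσB, hl, hin g hg, hgx, Equiv.symm_apply_apply]
  rcases hβ _ _ hmatch with hbot | htop
  · have hB1 : ∀ g, σB g = 1 := by
      intro g
      have := (hmatch (σB g)).1 ⟨g, rfl⟩
      rw [hbot, Subgroup.mem_bot, ← hβ1] at this
      exact β.injective this
    have hS1 : ∀ g, σS g = 1 := by
      intro g
      have : σS g ∈ σS.range := ⟨g, rfl⟩
      rwa [hbot, Subgroup.mem_bot] at this
    intro g hg x
    obtain ⟨h, hh, -, hl⟩ := hmove g hg x
    rw [← hl]
    exact Prod.ext (hS1 ⟨h, hh⟩) (hB1 ⟨h, hh⟩)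
  · exfalso
    -- An element of `H` with trivial `B`-part fixes `of 1` and has trivial `S`-part there;
    -- conjugating by the generator moves this local action back to `1`.
    refine false_of_conj_ker_le_ker hS H σS σB (MonoidHom.range_eq_top.1 htop)
      (leftHom β c (of 1)) ?_
    rintro ⟨g, hg⟩ hgB
    obtain ⟨h, hh, he, hl⟩ := hmove g hg.1 (of 1)
    rw [hσB] at hgB
    rw [(hout g hg).1, hgB] at he
    refine ⟨⟨h, hh⟩, he, ?_⟩
    rw [hσS, hl, (hout g hg).2, hgB, hβ1]

end FreeGroup

/-! ### Conclusion -/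

theorem theorem1p3 :
    ∃ X : TreeWithFins, X.LocallyFinite ∧
      ∃ Γ Γ' : Subgroup X.Aut,
        (TreeWithFins.IsUniformLattice Γ ∧ TreeWithFins.ActsFreely Γ) ∧
        (TreeWithFins.IsUniformLattice Γ' ∧ TreeWithFins.ActsFreely Γ') ∧
        ¬ ∃ Λ : Subgroup X.Aut, TreeWithFins.IsUniformLattice Λ ∧
          TreeWithFins.ContainsConjugate Λ Γ ∧ TreeWithFins.ContainsConjugate Λ Γ' := by
  obtain ⟨β, hβ1, hβ⟩ := exists_equiv_alternatingGroup_five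
  obtain ⟨β', hβ'⟩ := exists_equiv_not_eq_translate β (by
    rw [Nat.card_congr β, card_alternatingGroup_five]; norm_num)
  have : Finite (Multiplicative (ZMod 60)) := Finite.of_equiv _ β.symm
  obtain ⟨c, hc⟩ := Countable.exists_injective_nat
    (Multiplicative (ZMod 60) ⊕ alternatingGroup (Fin 5))
  refine ⟨(FreeGroup.cayleyTree β).withFins (FreeGroup.labelHom _ _) c,
    withFins_locallyFinite _ _ _, (FreeGroup.leftHom β c).range,
    (FreeGroup.twistedHom β β' c).range, FreeGroup.leftHom_range β c,
    FreeGroup.twistedHom_range β β' c, ?_⟩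
  rintro ⟨Λ, hΛ, ⟨g₁, h₁⟩, ⟨g₂, h₂⟩⟩
  -- Conjugating `Λ` by `g₁⁻¹` makes it contain the left translations themselves; the second lattice
  -- is then conjugated into it by `g₁⁻¹ * g₂`.
  let Λ' := Λ.comap (MulAut.conj g₁).toMonoidHom
  have hmem : ∀ g, g ∈ Λ' ↔ g₁ * g * g₁⁻¹ ∈ Λ := fun g => Iff.rfl
  let v₀ : ((FreeGroup.cayleyTree β).withFins (FreeGroup.labelHom _ _) c).Vertex :=
    Sum.inl (Sum.inl 1)
  have hfin : Finite {g : ((FreeGroup.cayleyTree β).withFins (FreeGroup.labelHom _ _) c).Aut //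
      g ∈ Λ' ∧ base g 1 = 1} := by
    have := hΛ.1 ((g₁ : Equiv.Perm _) v₀)
    refine Finite.of_injective (β := MulAction.stabilizer Λ ((g₁ : Equiv.Perm _) v₀))
      (fun g => ⟨⟨g₁ * g.1 * g₁⁻¹, g.2.1⟩, ?_⟩) ?_
    · have h := inl_inl_base g.1 1
      rw [g.2.2] at h
      change (g₁ : Equiv.Perm _) ((g.1 : Equiv.Perm _)
        ((g₁⁻¹ : Equiv.Perm _) ((g₁ : Equiv.Perm _) v₀))) = (g₁ : Equiv.Perm _) v₀
      have h' : (g₁⁻¹ : Equiv.Perm _) ((g₁ : Equiv.Perm _) v₀) = v₀ :=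
        Equiv.symm_apply_apply (g₁ : Equiv.Perm _) v₀
      rw [h', ← h]
    · intro g g' h
      have h1 := congrArg Subtype.val (congrArg Subtype.val h)
      ext1
      simpa using h1
  have hloc := FreeGroup.eq_one_of_forall_leftHom_mem commutator_alternatingGroup_five hβ1 hβ hc Λ'
    hfin (fun u => h₁ _ ⟨u, rfl⟩)
  obtain ⟨s, b, hsb⟩ := FreeGroup.exists_eq_translate (β' := β') hc Λ' hloc (g₁⁻¹ * g₂) (fun u => by
    rw [hmem]
    have := h₂ _ ⟨u, rfl⟩
    convert this using 1
    group)
  obtain ⟨i, hi⟩ := hβ' s b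
  exact hi (hsb i)
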